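/- Let $n\ge 2$, let $g_0=\langle\cdot,\cdot\rangle$ be the Euclidean metric on $\mathbb{R}^{n+1}$, and let $g_S=\phi^{-2}g_0$ with $\phi(x)=\frac{1+\sum_{i=1}^{n+1}(x^i)^2}{2}$, so that $(\mathbb{R}^{n+1},g_S)$ is the round unit $(n+1)$-sphere minus a point. Let $M$ be an (immersed) $C^2$ hypersurface in $(\mathbb{R}^{n+1},g_S)$ and let $\Sigma=M\cap\{x^{n+1}=\epsilon\}$, where $\epsilon$ is a regular value of the height function $x^{n+1}$ on $M$. At a point of $\Sigma$, let $\nu$ be a $g_0$-unit normal vector to $M$ in $\mathbb{R}^{n+1}$ and $\eta$ a $g_0$-unit normal vector to $\Sigma$ in $\mathbb{R}^n\times\{\epsilon\}$. Let $\bar A$ be the shape operator of $M$ in $(\mathbb{R}^{n+1},g_S)$ with respect to the $g_S$-unit normal $\phi\nu$, and $\bar A_\Sigma$ the shape operator of $\Sigma$ in $(\mathbb{R}^n\times\{\epsilon\},g_S)$ with respect to $\phi\eta$; here the shape operator of a hypersurface with unit normal $\mu$ and coordinate frame $e_1,e_2,\dots$ is $A^i_j=\sum_k g^{ik}g(\mu,\nabla_{e_k}e_j)$.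 Let $\bar H=\operatorname{tr}\bar A$ and $\bar H_\Sigma=\operatorname{tr}\bar A_\Sigma$ be the mean curvatures, and let $R$ be the scalar curvature of the metric induced by $g_S$ on $M$. (As this metric may be only $C^1$ in coordinates, $R$ is understood as the continuous function which represents the scalar curvature in the sense of distributions; it is the classical scalar curvature whenever the induced metric is $C^2$.) Then at every point of $\Sigma$ \[ \bar H\Big[g_0(\nu,\eta)\bar H_\Sigma+(n-1)g_0(\nu,\partial_{n+1})x^{n+1}\Big]\ \ge\ \tfrac12\big[R-n(n-1)\big]+\frac{n}{2(n-1)}\Big[g_0(\nu,\eta)\bar H_\Sigma+(n-1)g_0(\nu,\partial_{n+1})x^{n+1}\Big]^2 . \] Equality holds at a point of $\Sigma$ if and only if both of the following hold at that point: (i) $\Sigma$ is umbilic in $(\mathbb{R}^n\times\{\epsilon\},g_S)$, i.e. $\bar A_\Sigma=\kappa\,\mathrm{Id}$ for some real $\kappa$; and (ii) with this $\kappa$, $M$ has in $(\mathbb{R}^{n+1},g_S)$ the principal curvature $g_0(\nu,\eta)\kappa+g_0(\nu,\partial_{n+1})\,\partial_{n+1}\phi$ with multiplicity at least $n-1$.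 -/

import Mathlib

open scoped Manifold ContDiff

namespace SphereHypersurface

noncomputable section

/-- The coordinate space `ℝᵐ` with its Euclidean inner product `g₀`. -/
abbrev E (m : ℕ) : Type := EuclideanSpace ℝ (Fin m)

/-- The partial derivative `∂ᵢ f` of a map on `ℝᵐ`. -/
def pd {m : ℕ} {V : Type*} [NormedAddCommGroup V] [NormedSpace ℝ V]
    (i : Fin m) (f : E m → V) (x : E m) : V :=
  fderiv ℝ f x (EuclideanSpace.single i 1)

/-- A Riemannian metric on (an open subset of) `ℝᵐ`, given by its coefficients `g_{ij}(x)`.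
The metrics used here are `roundMetric` and its pull-backs under immersions. -/
abbrev MetricField (m : ℕ) : Type := E m → Matrix (Fin m) (Fin m) ℝ

/-- The Christoffel symbol
`Γᵏᵢⱼ = ½ ∑ₗ gᵏˡ (∂ᵢ g_{jl} + ∂ⱼ g_{il} - ∂ₗ g_{ij})` of the Levi-Civita connection of `g`. -/
def christoffel {m : ℕ} (g : MetricField m) (k i j : Fin m) (x : E m) : ℝ :=
  (1 / 2) * ∑ l, (g x)⁻¹ k l *
    (pd i (fun y => g y j l) x + pd j (fun y => g y i l) x - pd l (fun y => g y i j) x)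

/-- The pull-back `F^* g` of the metric `g` under a map `F`, i.e. the first fundamental form
`g(∂ᵢ F, ∂ⱼ F)` when `F` parametrizes a submanifold. -/
def inducedMetric {d m : ℕ} (g : MetricField m) (F : E d → E m) : MetricField d :=
  fun u => Matrix.of fun i j => ∑ a, ∑ b, g (F u) a b * pd i F u a * pd j F u b

/-- The covariant derivative `∇_{eᵢ} eⱼ` of the coordinate frame `eⱼ = ∂ⱼ F` along `F`, with respect
to the Levi-Civita connection of `g`; this is the component with index `b`. -/
def covFrame {d m : ℕ} (g : MetricField m) (F : E d → E m) (i j : Fin d) (u : E d)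
    (b : Fin m) : ℝ :=
  pd i (pd j F) u b + ∑ c, ∑ e, christoffel g b c e (F u) * pd i F u c * pd j F u e

/-- The second fundamental form `g(ν, ∇_{eᵢ} eⱼ)` at the parameter `u`, with respect to the vector
`ν`, which is to be a `g`-unit normal vector at `F u`. -/
def secondForm {d m : ℕ} (g : MetricField m) (F : E d → E m) (ν : E m) (u : E d) :
    Matrix (Fin d) (Fin d) ℝ :=
  Matrix.of fun i j => ∑ a, ∑ b, g (F u) a b * ν a * covFrame g F i j u b

/-- The shape operator `Aⁱⱼ = ∑ₖ gⁱᵏ g(ν, ∇_{eₖ} eⱼ)` in the coordinate frame of `F`. -/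
def shapeOperator {d m : ℕ} (g : MetricField m) (F : E d → E m) (ν : E m) (u : E d) :
    Matrix (Fin d) (Fin d) ℝ :=
  (inducedMetric g F u)⁻¹ * secondForm g F ν u

/-- `ν` is a `g₀`-unit vector which is `g₀`-orthogonal to the image of the differential of `F`. -/
def IsUnitNormal {d m : ℕ} (F : E d → E m) (ν : E m) (u : E d) : Prop :=
  ‖ν‖ = 1 ∧ ∀ v : E d, inner ℝ ν (fderiv ℝ F u v) = 0

/-- `R` is the scalar curvature of the metric `h` on the open set `U ⊆ ℝᵈ`.

The classical formula is
`R = ∑ hʲᵏ (∂ᵢ Γⁱⱼₖ - ∂ⱼ Γⁱᵢₖ + Γⁱᵢₗ Γˡⱼₖ - Γⁱⱼₗ Γˡᵢₖ)`.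
The metric of a `C²` hypersurface is only `C¹` in coordinates, so its Christoffel symbols are only
continuous. Therefore the two derivatives of Christoffel symbols are taken in the
sense of distributions: `R` is a continuous function, and the formula holds after multiplication by
any test function `ψ` and integration by parts. If `h` is of class `C²`, then this says exactly that
`R` is given on `U` by the classical formula. -/
def IsScalarCurvatureOn {d : ℕ} (h : MetricField d) (U : Set (E d)) (R : E d → ℝ) : Prop :=
  ContinuousOn R U ∧
    ∀ ψ : E d → ℝ, ContDiff ℝ ∞ ψ → HasCompactSupport ψ → tsupport ψ ⊆ U →
      ∫ u, R u * ψ u =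
        ∫ u, ∑ j, ∑ k,
          ((∑ i, (-(pd i (fun y => ψ y * (h y)⁻¹ j k) u * christoffel h i j k u)
              + pd j (fun y => ψ y * (h y)⁻¹ j k) u * christoffel h i i k u))
            + ψ u * (h u)⁻¹ j k *
              ∑ i, ∑ l, (christoffel h i i l u * christoffel h l j k u
                - christoffel h i j l u * christoffel h l i k u))

/-- The function `φ(x) = (1 + |x|²) / 2`. -/
def conf {m : ℕ} (x : E m) : ℝ := (1 + ∑ i, x i ^ 2) / 2

/-- The round metric `g_S = φ⁻² g₀` on `ℝᵐ` (the unit sphere in stereographic coordinates). -/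
def roundMetric (m : ℕ) : MetricField m := fun x => (conf x ^ 2)⁻¹ • (1 : Matrix _ _ ℝ)

/-- The inclusion `y ↦ (y, ε)` of `ℝⁿ` onto the horizontal hyperplane `ℝⁿ × {ε}`. -/
def slice {n : ℕ} (ε : ℝ) (y : E n) : E (n + 1) :=
  WithLp.toLp 2 (Fin.snoc (α := fun _ => ℝ) (fun i => y i) ε)

/-- The projection `ℝⁿ × ℝ → ℝⁿ`. -/
def horizontal {n : ℕ} (x : E (n + 1)) : E n :=
  WithLp.toLp 2 fun i => x i.castSucc

/-- The coordinate vector field `∂_{n+1}`. -/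
def vertical (n : ℕ) : E (n + 1) := EuclideanSpace.single (Fin.last n) 1

section Hypersurface

variable {n : ℕ} {M : Type*} [TopologicalSpace M] [ChartedSpace (E n) M]

/-- `ι : M → ℝⁿ⁺¹` is a `C²` immersion of the `n`-manifold `M`. -/
def IsC2Immersion (ι : M → E (n + 1)) : Prop :=
  ContMDiff (𝓡 n) 𝓘(ℝ, E (n + 1)) 2 ι ∧
    ∀ p : M, Function.Injective (mfderiv (𝓡 n) 𝓘(ℝ, E (n + 1)) ι p)

/-- The height function `x^{n+1}` on `M`. -/
def height (ι : M → E (n + 1)) (p : M) : ℝ := ι p (Fin.last n)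

/-- The level set `Σ = M ∩ {x^{n+1} = ε}`. -/
def levelSet (ι : M → E (n + 1)) (ε : ℝ) : Set M := {p | height ι p = ε}

/-- `ε` is a regular value of the height function on `M`. -/
def IsRegularValue (ι : M → E (n + 1)) (ε : ℝ) : Prop :=
  ∀ p ∈ levelSet ι ε, mfderiv (𝓡 n) 𝓘(ℝ, ℝ) (height ι) p ≠ 0

/-- `s : W → M` is a local `C²` parametrization (by an immersion) of the `(n-1)`-dimensional
submanifold `S` of `M`, with `W` an open subset of `ℝⁿ⁻¹`. -/
def IsLocalParam (S : Set M) (W : Set (E (n - 1))) (s : E (n - 1) → M) : Prop :=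
  IsOpen W ∧ ContMDiffOn (𝓡 (n - 1)) (𝓡 n) 2 s W ∧ Set.MapsTo s W S ∧
    ∀ w ∈ W, Function.Injective (mfderiv (𝓡 (n - 1)) (𝓡 n) s w)

/-- `R : M → ℝ` is the scalar curvature of the metric which the round metric `g_S` of `ℝⁿ⁺¹`
induces on `M`. -/
def IsScalarCurvature (ι : M → E (n + 1)) (R : M → ℝ) : Prop :=
  ∀ e ∈ atlas (E n) M,
    IsScalarCurvatureOn (inducedMetric (roundMetric (n + 1)) (ι ∘ e.symm)) e.target (R ∘ e.symm)

/-- The shape operator of `M` in `(ℝⁿ⁺¹, g_S)` at the point `p`, in the coordinates of the chart `e`,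
with respect to the `g_S`-unit normal vector `φ ν`, where `ν` is a `g₀`-unit normal vector. -/
def shapeM (ι : M → E (n + 1)) (e : OpenPartialHomeomorph M (E n)) (ν : E (n + 1)) (p : M) :
    Matrix (Fin n) (Fin n) ℝ :=
  shapeOperator (roundMetric (n + 1)) (ι ∘ e.symm) (conf (ι p) • ν) (e p)

/-- The shape operator of the level set in `(ℝⁿ × {ε}, g_S)` at the point `s b`, in the coordinates
of the local parametrization `s`, with respect to the `g_S`-unit normal vector `φ η`, where `η` is a
`g₀`-unit normal vector in `ℝⁿ`. The metric of `ℝⁿ × {ε}` is the restriction of `g_S`. -/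
def shapeLevel (ι : M → E (n + 1)) (ε : ℝ) (s : E (n - 1) → M) (η : E n) (b : E (n - 1)) :
    Matrix (Fin (n - 1)) (Fin (n - 1)) ℝ :=
  shapeOperator (inducedMetric (roundMetric (n + 1)) (slice ε)) (horizontal ∘ ι ∘ s)
    (conf (ι (s b)) • η) b

/-- The bracket `g₀(ν, η) H̄_Σ + (n - 1) g₀(ν, ∂_{n+1}) x^{n+1}` at the point `s b`. -/
def bracket (ι : M → E (n + 1)) (ε : ℝ) (s : E (n - 1) → M) (ν : E (n + 1)) (η : E n)
    (b : E (n - 1)) : ℝ :=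
  inner ℝ ν (slice 0 η) * (shapeLevel ι ε s η b).trace
    + ((n : ℝ) - 1) * inner ℝ ν (vertical n) * height ι (s b)

end Hypersurface

end

end SphereHypersurface

open scoped Manifold ContDiff

namespace SphereHypersurface

open MeasureTheory Filter Topology

noncomputable section

/-! The inequality is linear algebra once two geometric identities are known. Put `k = n - 1`, let
`S` be the shape operator of the hypersurface, and split its tangent space orthogonally into the
tangent space of the level set and a unit normal `N`. In this splitting `S` has a tangential block
`T`, an off-diagonal vector `v` and a corner entry `a`, so that `tr S = tr T + a` and `tr S² = tr T²
+ 2|v|² + a²`. Hence `tr S · tr T - ½((tr S)² - tr S²) - (n/2k)(tr T)²` equals `½|T - (tr T/k) Id|²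
+ |v|²`, which is nonnegative. It vanishes exactly when `T` is a multiple `r` of the identity and `v
= 0`; given the former, `v = 0` amounts to an `r`-eigenspace of `S` of dimension at least `k`
(`trace_inequality`).

The first identity is `T = α Ā_Σ + c Id` with `α = g₀(ν, η)` and `c = g₀(ν, ∂_{n+1}) x^{n+1}`; its
trace is the bracket. It holds because the horizontal part of `ν` is `α η`, while the second
derivatives of a parametrization of the level set are horizontal (`meanCurvature_comparison`).
Regularity of `ε` gives `α ≠ 0`, so that `T` is scalar if and only if `Ā_Σ` is.

The second identity is the Gauss equation `R - n(n-1) = (tr S)² - tr S²` (`scalarCurvature_eq`). For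
a `C²` immersion the Christoffel symbols cannot be differentiated. Inverse stereographic projection
turns the immersion into one into a Euclidean space, where `Γⁱⱼₖ = ⟨Fⁱ, ∂ⱼ∂ₖF⟩` for the dual frame
`Fⁱ`. The weak formula for `R` then differs from the extrinsic expression only by integrals of
`⟨∂ⱼX, ∂ᵢ∂ₖF⟩ - ⟨∂ᵢX, ∂ⱼ∂ₖF⟩`, with `X` of class `C¹` and compactly supported; these vanish because
weak derivatives of the `C¹` map `∂ₖF` commute (`integral_inner_fderiv_comm_of_contDiffOn`,
`eqOn_gaussScalar`). -/

/-! ### Cut-off functions and translation of integrals -/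

lemma contDiff_of_tsupport_subset {D V : Type*} [NormedAddCommGroup D] [NormedSpace ℝ D]
    [NormedAddCommGroup V] [NormedSpace ℝ V] {U : Set D} (hU : IsOpen U) {X : D → V} {n : ℕ∞ω}
    (hX : ContDiffOn ℝ n X U) (hXU : tsupport X ⊆ U) : ContDiff ℝ n X := by
  rw [← contMDiff_iff_contDiff]
  exact contMDiff_of_tsupport fun x hx => (hX.contDiffAt (hU.mem_nhds (hXU hx))).contMDiffAt

lemma exists_contDiff_one_nhds {D : Type*} [NormedAddCommGroup D] [NormedSpace ℝ D]
    [FiniteDimensional ℝ D] {K U : Set D} (hK : IsCompact K) (hU : IsOpen U) (hKU : K ⊆ U) :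
    ∃ χ : D → ℝ, ContDiff ℝ ∞ χ ∧ HasCompactSupport χ ∧ tsupport χ ⊆ U ∧
      ∀ᶠ x in 𝓝ˢ K, χ x = 1 := by
  obtain ⟨L, hL, hKL, hLU⟩ := exists_compact_between hK hU hKU
  obtain ⟨f, hf1, hf0, -⟩ := exists_contMDiffMap_one_nhds_of_subset_interior (n := (⊤ : ℕ∞)) 𝓘(ℝ, D)
    hK.isClosed hKL
  have hsub : tsupport f ⊆ L := by
    refine closure_minimal (fun x hx => ?_) hL.isClosed
    by_contra h
    exact hx (hf0 x h)
  exact ⟨f, f.contMDiff.contDiff, hL.of_isClosed_subset (isClosed_tsupport _) hsub,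
    hsub.trans hLU, hf1⟩

/-- Discrete integration by parts: translation invariance of the measure moves a finite difference
to the other factor and reverses its direction. -/
lemma integral_translate_sub_mul {D : Type*} [NormedAddCommGroup D] [MeasurableSpace D]
    [BorelSpace D] (μ : Measure D) [μ.IsAddHaarMeasure] {f g : D → ℝ} (hf : Continuous f)
    (hg : Continuous g)
    (hgc : HasCompactSupport g) (v : D) :
    ∫ x, (f (x + v) - f x) * g x ∂μ = ∫ x, f x * (g (x - v) - g x) ∂μ := by
  have S3 : ∫ x, f (x + v) * g x ∂μ = ∫ x, f x * g (x - v) ∂μ := by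
    rw [← integral_add_right_eq_self _ (-v)]; simp [sub_eq_add_neg]
  have i1 : Integrable (fun x => f x * g x) μ :=
    (hf.mul hg).integrable_of_hasCompactSupport hgc.mul_left
  have i2 : Integrable (fun x => f (x + v) * g x) μ :=
    ((hf.comp (continuous_add_const v)).mul hg).integrable_of_hasCompactSupport hgc.mul_left
  have i3 : Integrable (fun x => f x * g (x - v)) μ := by
    have := i2.comp_add_right (-v)
    simpa [sub_eq_add_neg] using this
  simp_rw [sub_mul, mul_sub]
  rw [integral_sub i2 i1, integral_sub i3 i1, S3]

/-! ### Commuting weak derivatives of `C¹` maps -/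

section MixedPartials

variable {D : Type*} [NormedAddCommGroup D] [NormedSpace ℝ D] [FiniteDimensional ℝ D]
  [MeasurableSpace D] [BorelSpace D] (μ : Measure D) [μ.IsAddHaarMeasure]

/-- The distributional mixed partial derivatives of a `C¹` function commute. -/
lemma integral_fderiv_mul_fderiv_comm {X G : D → ℝ} (hX : ContDiff ℝ 1 X)
    (hXc : HasCompactSupport X) (hG : ContDiff ℝ 1 G) (hGc : HasCompactSupport G) (v w : D) :
    ∫ x, fderiv ℝ X x v * fderiv ℝ G x w ∂μ = ∫ x, fderiv ℝ X x w * fderiv ℝ G x v ∂μ := by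
  obtain ⟨CX, hCX⟩ := hX.lipschitzWith_of_hasCompactSupport hXc one_ne_zero
  obtain ⟨CG, hCG⟩ := hG.lipschitzWith_of_hasCompactSupport hGc one_ne_zero
  have cX : ∀ v, Continuous fun x => fderiv ℝ X x v := fun v =>
    (hX.continuous_fderiv one_ne_zero).clm_apply continuous_const
  have cG : ∀ v, Continuous fun x => fderiv ℝ G x v := fun v =>
    (hG.continuous_fderiv one_ne_zero).clm_apply continuous_const
  have sX : ∀ v, HasCompactSupport fun x => fderiv ℝ X x v := fun v => hXc.fderiv_apply ℝ v
  have sG : ∀ v, HasCompactSupport fun x => fderiv ℝ G x v := fun v => hGc.fderiv_apply ℝ v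
  -- As second derivatives need not exist, the derivative in direction `w` is replaced by a
  -- difference quotient. The limit in `B` is taken along `-w` because moving a difference quotient
  -- to the other factor reverses its direction.
  have A := hCG.integral_inv_smul_sub_mul_tendsto_integral_lineDeriv_mul
    ((cX v).integrable_of_hasCompactSupport (μ := μ) (sX v)) w
  have B := (hCX.integral_inv_smul_sub_mul_tendsto_integral_lineDeriv_mul
    ((cG v).integrable_of_hasCompactSupport (μ := μ) (sG v)) (-w)).neg
  -- For a fixed step `t` the difference of `G` is itself `C¹`, so one may integrate by parts in
  -- direction `v` and then shift the difference from `∂ᵥG` to `X`.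
  have key : ∀ t : ℝ, ∫ x, (t⁻¹ • (G (x + t • w) - G x)) * fderiv ℝ X x v ∂μ
      = -∫ x, (t⁻¹ • (X (x + t • (-w)) - X x)) * fderiv ℝ G x v ∂μ := by
    intro t
    have hT : ContDiff ℝ 1 fun x => G (x + t • w) := hG.comp (contDiff_id.add contDiff_const)
    have hY : ContDiff ℝ 1 fun x => G (x + t • w) - G x := hT.sub hG
    have hd : ∀ x, fderiv ℝ (fun x => G (x + t • w) - G x) x v
        = fderiv ℝ G (x + t • w) v - fderiv ℝ G x v := by
      intro x
      rw [fderiv_fun_sub (hT.differentiable one_ne_zero x) (hG.differentiable one_ne_zero x),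
        fderiv_comp_add_right]
      rfl
    have cY : Continuous fun x => fderiv ℝ (fun x => G (x + t • w) - G x) x v :=
      (hY.continuous_fderiv one_ne_zero).clm_apply continuous_const
    have ibp := integral_mul_fderiv_eq_neg_fderiv_mul_of_integrable (μ := μ) (v := v)
      (f := fun x => G (x + t • w) - G x) (g := X)
      ((cY.mul hX.continuous).integrable_of_hasCompactSupport hXc.mul_left)
      ((hY.continuous.mul (cX v)).integrable_of_hasCompactSupport (sX v).mul_left)
      ((hY.continuous.mul hX.continuous).integrable_of_hasCompactSupport hXc.mul_left)
      (fun x _ => hY.differentiable one_ne_zero x) (fun x _ => hX.differentiable one_ne_zero x)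
    have tr := integral_translate_sub_mul μ (cG v) hX.continuous hXc (t • w)
    simp_rw [hd] at ibp
    rw [tr] at ibp
    simp_rw [smul_eq_mul, mul_assoc]
    rw [integral_const_mul, integral_const_mul, ibp, smul_neg]
    simp_rw [← sub_eq_add_neg, mul_comm (fderiv ℝ G _ v)]
    ring
  simp_rw [key] at A
  have := tendsto_nhds_unique A B
  have lX : ∀ x, lineDeriv ℝ X x (-w) = - fderiv ℝ X x w := fun x => by
    rw [(hX.differentiable one_ne_zero x).lineDeriv_eq_fderiv, map_neg]
  have lG : ∀ x, lineDeriv ℝ G x w = fderiv ℝ G x w := fun x =>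
    (hG.differentiable one_ne_zero x).lineDeriv_eq_fderiv
  simp_rw [lX, lG, neg_mul, integral_neg, neg_neg] at this
  rw [← this]
  simp_rw [mul_comm]

variable {V : Type*} [NormedAddCommGroup V] [InnerProductSpace ℝ V] [FiniteDimensional ℝ V]

lemma integral_inner_fderiv_comm {X G : D → V} (hX : ContDiff ℝ 1 X)
    (hXc : HasCompactSupport X) (hG : ContDiff ℝ 1 G) (hGc : HasCompactSupport G) (v w : D) :
    ∫ x, inner ℝ (fderiv ℝ X x v) (fderiv ℝ G x w) ∂μ
      = ∫ x, inner ℝ (fderiv ℝ X x w) (fderiv ℝ G x v) ∂μ := by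
  let b := stdOrthonormalBasis ℝ V
  have comp : ∀ {Y : D → V}, ContDiff ℝ 1 Y → ∀ i x u,
      inner ℝ (b i) (fderiv ℝ Y x u) = fderiv ℝ (fun x => inner ℝ (b i) (Y x)) x u := by
    intro Y hY i x u
    rw [fderiv_inner_apply ℝ (differentiableAt_const _) (hY.differentiable one_ne_zero x)]
    simp
  have hsum : ∀ u u', ∫ x, inner ℝ (fderiv ℝ X x u) (fderiv ℝ G x u') ∂μ
      = ∑ i, ∫ x, fderiv ℝ (fun x => inner ℝ (b i) (X x)) x u
          * fderiv ℝ (fun x => inner ℝ (b i) (G x)) x u' ∂μ := by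
    intro u u'
    rw [← integral_finsetSum]
    · refine integral_congr_ae (Eventually.of_forall fun x => ?_)
      simp only [← comp hX, ← comp hG]
      rw [← b.sum_inner_mul_inner]
      simp_rw [real_inner_comm]
    · intro i _
      have h1 : ContDiff ℝ 1 fun x => inner ℝ (b i) (X x) := contDiff_const.inner ℝ hX
      have h2 : ContDiff ℝ 1 fun x => inner ℝ (b i) (G x) := contDiff_const.inner ℝ hG
      refine Continuous.integrable_of_hasCompactSupport
        (((h1.continuous_fderiv one_ne_zero).clm_apply continuous_const).mul
        ((h2.continuous_fderiv one_ne_zero).clm_apply continuous_const)) ?_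
      refine HasCompactSupport.mul_right (HasCompactSupport.fderiv_apply ℝ ?_ u)
      exact hXc.comp_left (g := fun y => inner ℝ (b i) y) (inner_zero_right _)
  rw [hsum, hsum]
  refine Finset.sum_congr rfl fun i _ => integral_fderiv_mul_fderiv_comm μ
    (contDiff_const.inner ℝ hX) (hXc.comp_left (g := fun y => inner ℝ (b i) y) (inner_zero_right _))
    (contDiff_const.inner ℝ hG) (hGc.comp_left (g := fun y => inner ℝ (b i) y) (inner_zero_right _))
    v w

/-- Multiplying `G` by a cut-off equal to one near the support of `X` changes neither integrand,
since the derivative of `X` vanishes elsewhere. -/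
lemma integral_inner_fderiv_comm_of_contDiffOn {U : Set D} (hU : IsOpen U) {X G : D → V}
    (hX : ContDiff ℝ 1 X) (hXc : HasCompactSupport X) (hXU : tsupport X ⊆ U)
    (hG : ContDiffOn ℝ 1 G U) (v w : D) :
    ∫ x, inner ℝ (fderiv ℝ X x v) (fderiv ℝ G x w) ∂μ
      = ∫ x, inner ℝ (fderiv ℝ X x w) (fderiv ℝ G x v) ∂μ := by
  obtain ⟨χ, hχ, hχc, hχU, hχ1⟩ := exists_contDiff_one_nhds hXc hU hXU
  have hG' : ContDiff ℝ 1 fun x => χ x • G x := by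
    refine contDiff_of_tsupport_subset hU ?_
      ((closure_mono (Function.support_smul_subset_left χ G)).trans hχU)
    exact (hχ.of_le (by norm_cast)).contDiffOn.smul hG
  have hloc : ∀ u u' x, inner ℝ (fderiv ℝ X x u) (fderiv ℝ G x u')
      = inner ℝ (fderiv ℝ X x u) (fderiv ℝ (fun x => χ x • G x) x u') := by
    intro u u' x
    by_cases hx : x ∈ tsupport X
    · have h1 : (fun x => χ x • G x) =ᶠ[𝓝 x] G := by
        filter_upwards [(eventually_nhdsSet_iff_forall.1 hχ1) x hx] with y hy
        simp [hy]
      rw [h1.fderiv_eq]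
    · have : fderiv ℝ X x = 0 := by
        by_contra h
        exact hx (support_fderiv_subset ℝ h)
      simp [this]
  simp_rw [hloc]
  exact integral_inner_fderiv_comm μ hX hXc hG' hχc.smul_right v w

end MixedPartials

/-! ### Rules for partial derivatives and matrix inverses -/

section Calculus

variable {d : ℕ} {V : Type*} [NormedAddCommGroup V] [InnerProductSpace ℝ V]

lemma contDiffOn_pd {W : Type*} [NormedAddCommGroup W] [NormedSpace ℝ W] {U : Set (E d)}
    (hU : IsOpen U) {f : E d → W} {m n : ℕ∞ω} (hf : ContDiffOn ℝ n f U) (hmn : m + 1 ≤ n)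
    (i : Fin d) : ContDiffOn ℝ m (pd i f) U :=
  (hf.fderiv_of_isOpen hU hmn).clm_apply contDiffOn_const

lemma contDiffOn_det {ι : Type*} [Fintype ι] [DecidableEq ι] {D : Type*} [NormedAddCommGroup D]
    [NormedSpace ℝ D] {U : Set D} {n : ℕ∞ω} {A : D → Matrix ι ι ℝ}
    (hA : ∀ i j, ContDiffOn ℝ n (fun u => A u i j) U) : ContDiffOn ℝ n (fun u => (A u).det) U := by
  simp_rw [Matrix.det_apply]
  exact ContDiffOn.sum fun σ _ => (contDiffOn_prod fun i _ => hA _ _).const_smul _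

/-- Cramer's rule: each entry of the inverse is a quotient of determinants. -/
lemma contDiffOn_matrix_inv {ι : Type*} [Fintype ι] [DecidableEq ι] {D : Type*}
    [NormedAddCommGroup D] [NormedSpace ℝ D] {U : Set D} {n : ℕ∞ω} {A : D → Matrix ι ι ℝ}
    (hA : ∀ i j, ContDiffOn ℝ n (fun u => A u i j) U) (hdet : ∀ u ∈ U, IsUnit (A u).det)
    (i j : ι) : ContDiffOn ℝ n (fun u => (A u)⁻¹ i j) U := by
  simp_rw [Matrix.inv_def, Matrix.smul_apply, Ring.inverse_eq_inv', Matrix.adjugate_apply]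
  refine ContDiffOn.smul ((contDiffOn_det hA).inv fun u hu => (hdet u hu).ne_zero)
    (contDiffOn_det fun k l => ?_)
  by_cases hk : k = j
  · subst hk
    simpa using contDiffOn_const
  · simpa [Matrix.updateRow_apply, hk] using hA k l

lemma pd_inner {f g : E d → V} {x : E d} (hf : DifferentiableAt ℝ f x)
    (hg : DifferentiableAt ℝ g x) (i : Fin d) :
    pd i (fun y => inner ℝ (f y) (g y)) x
      = inner ℝ (pd i f x) (g x) + inner ℝ (f x) (pd i g x) := by
  rw [pd, fderiv_inner_apply ℝ hf hg, add_comm]; rfl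

lemma pd_smul {f : E d → ℝ} {g : E d → V} {x : E d} (hf : DifferentiableAt ℝ f x)
    (hg : DifferentiableAt ℝ g x) (i : Fin d) :
    pd i (fun y => f y • g y) x = pd i f x • g x + f x • pd i g x := by
  rw [pd, fderiv_fun_smul hf hg, add_comm]; rfl

lemma pd_sum {ι : Type*} (s : Finset ι) {f : ι → E d → V} {x : E d}
    (hf : ∀ k ∈ s, DifferentiableAt ℝ (f k) x) (i : Fin d) :
    pd i (fun y => ∑ k ∈ s, f k y) x = ∑ k ∈ s, pd i (f k) x := by
  rw [pd, fderiv_fun_sum hf, _root_.sum_apply]; rfl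

lemma pd_congr {W : Type*} [NormedAddCommGroup W] [NormedSpace ℝ W] {f g : E d → W} {x : E d}
    (h : f =ᶠ[𝓝 x] g) (i : Fin d) : pd i f x = pd i g x := by
  rw [pd, h.fderiv_eq]; rfl

lemma pd_pd_comm {f : E d → V} {x : E d} (hf : ContDiffAt ℝ 2 f x) (i j : Fin d) :
    pd i (pd j f) x = pd j (pd i f) x := by
  have hs := hf.isSymmSndFDerivAt (by simp)
  have hd : DifferentiableAt ℝ (fderiv ℝ f) x :=
    (hf.fderiv_right (m := 1) (by norm_num)).differentiableAt one_ne_zero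
  have key : ∀ i j : Fin d, pd i (pd j f) x
      = fderiv ℝ (fderiv ℝ f) x (EuclideanSpace.single i 1) (EuclideanSpace.single j 1) := by
    intro i j
    change fderiv ℝ (fun y => fderiv ℝ f y (EuclideanSpace.single j 1)) x _ = _
    rw [fderiv_clm_apply hd (differentiableAt_const _)]
    simp
  rw [key, key]
  exact hs _ _

end Calculus

/-! ### Tangential and normal parts of second derivatives of a Euclidean immersion -/

section Gauss

variable {d : ℕ} {V : Type*} [NormedAddCommGroup V] [InnerProductSpace ℝ V]

/-- The frame dual to the coordinate frame `∂ₘ F` with respect to the metric `h`. -/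
def dualFrame (h : MetricField d) (F : E d → V) (i : Fin d) (u : E d) : V :=
  ∑ m, (h u)⁻¹ i m • pd m F u

/-- The normal part of the second derivative `∂ᵢ ∂ₖ F`, i.e. the vector-valued second
fundamental form. -/
def normalPart (h : MetricField d) (F : E d → V) (i k : Fin d) (u : E d) : V :=
  pd i (pd k F) u - ∑ l, christoffel h l i k u • pd l F u

/-- The scalar curvature of a submanifold of a Euclidean space, as given by the Gauss equation. -/
def gaussScalar (h : MetricField d) (F : E d → V) (u : E d) : ℝ :=
  ∑ j, ∑ k, ∑ i, ∑ m, (h u)⁻¹ j k * (h u)⁻¹ i m *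
    (inner ℝ (normalPart h F i m u) (normalPart h F j k u)
      - inner ℝ (normalPart h F j m u) (normalPart h F i k u))

/-- `F` is a `C²` isometric immersion of `(U, h)` into a Euclidean space. -/
structure IsIsometricImmersionOn (h : MetricField d) (F : E d → V) (U : Set (E d)) : Prop where
  isOpen : IsOpen U
  contDiffOn : ContDiffOn ℝ 2 F U
  metric_eq : ∀ u ∈ U, ∀ j k, h u j k = inner ℝ (pd j F u) (pd k F u)
  isUnit_det : ∀ u ∈ U, IsUnit (h u).det

namespace IsIsometricImmersionOn

variable {h : MetricField d} {F : E d → V} {U : Set (E d)} (H : IsIsometricImmersionOn h F U)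

include H

lemma contDiffOn_pd (j : Fin d) : ContDiffOn ℝ 1 (pd j F) U :=
  SphereHypersurface.contDiffOn_pd H.isOpen H.contDiffOn (by norm_num) j

lemma contDiffOn_metric (j k : Fin d) : ContDiffOn ℝ 1 (fun u => h u j k) U :=
  ((H.contDiffOn_pd j).inner ℝ (H.contDiffOn_pd k)).congr fun u hu => H.metric_eq u hu j k

lemma contDiffOn_inv (j k : Fin d) : ContDiffOn ℝ 1 (fun u => (h u)⁻¹ j k) U :=
  contDiffOn_matrix_inv H.contDiffOn_metric H.isUnit_det j k

lemma contDiffOn_dualFrame (i : Fin d) : ContDiffOn ℝ 1 (dualFrame h F i) U :=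
  ContDiffOn.sum fun m _ => (H.contDiffOn_inv i m).smul (H.contDiffOn_pd m)

variable {u : E d} (hu : u ∈ U)

include hu

lemma differentiableAt {W : Type*} [NormedAddCommGroup W] [NormedSpace ℝ W] {f : E d → W}
    (hf : ContDiffOn ℝ 1 f U) : DifferentiableAt ℝ f u :=
  (hf.contDiffAt (H.isOpen.mem_nhds hu)).differentiableAt one_ne_zero

lemma symm (j k : Fin d) : h u j k = h u k j := by
  rw [H.metric_eq u hu, H.metric_eq u hu, real_inner_comm]

lemma pd_metric (i j l : Fin d) : pd i (fun y => h y j l) u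
    = inner ℝ (pd i (pd j F) u) (pd l F u) + inner ℝ (pd j F u) (pd i (pd l F) u) := by
  rw [← pd_inner (H.differentiableAt hu (H.contDiffOn_pd j))
    (H.differentiableAt hu (H.contDiffOn_pd l))]
  refine pd_congr ?_ i
  filter_upwards [H.isOpen.mem_nhds hu] with y hy using H.metric_eq y hy j l

lemma pd_comm (i j : Fin d) : pd i (pd j F) u = pd j (pd i F) u :=
  pd_pd_comm (H.contDiffOn.contDiffAt (H.isOpen.mem_nhds hu)) i j

/-- Koszul's formula: expanding the derivatives of the metric by the product rule, four of the six
terms cancel by symmetry of second derivatives and the other two agree. -/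
lemma christoffel_eq (l i k : Fin d) :
    christoffel h l i k u = inner ℝ (dualFrame h F l u) (pd i (pd k F) u) := by
  rw [christoffel, dualFrame, sum_inner, Finset.mul_sum]
  refine Finset.sum_congr rfl fun m _ => ?_
  rw [H.pd_metric hu, H.pd_metric hu, H.pd_metric hu, real_inner_smul_left, H.pd_comm hu k i,
    H.pd_comm hu m i, H.pd_comm hu m k, real_inner_comm (pd i (pd k F) u) (pd m F u),
    real_inner_comm (pd i (pd m F) u) (pd k F u)]
  ring

lemma inner_dualFrame (i l : Fin d) :
    inner ℝ (dualFrame h F i u) (pd l F u) = if i = l then 1 else 0 := by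
  have := congrFun (congrFun (Matrix.nonsing_inv_mul (h u) (H.isUnit_det u hu)) i) l
  rw [Matrix.mul_apply, Matrix.one_apply] at this
  rw [dualFrame, sum_inner, ← this]
  simp_rw [real_inner_smul_left, H.metric_eq u hu]

/-- Differentiate the duality relation `⟨Fⁱ, ∂ₗF⟩ = δⁱₗ`. -/
lemma inner_pd_dualFrame (i j l : Fin d) :
    inner ℝ (pd j (dualFrame h F i) u) (pd l F u) = - christoffel h i j l u := by
  have h0 : pd j (fun y => inner ℝ (dualFrame h F i y) (pd l F y)) u = 0 := by
    have : (fun y => inner ℝ (dualFrame h F i y) (pd l F y)) =ᶠ[𝓝 u]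
        fun _ => if i = l then (1 : ℝ) else 0 := by
      filter_upwards [H.isOpen.mem_nhds hu] with y hy using H.inner_dualFrame hy i l
    rw [pd_congr this, pd, fderiv_const_apply]; rfl
  rw [pd_inner (H.differentiableAt hu (H.contDiffOn_dualFrame i))
    (H.differentiableAt hu (H.contDiffOn_pd l)), ← H.christoffel_eq hu] at h0
  linarith

lemma inner_pd_normalPart (m i k : Fin d) :
    inner ℝ (pd m F u) (normalPart h F i k u) = 0 := by
  rw [normalPart, inner_sub_right, inner_sum]
  simp_rw [real_inner_smul_right, H.christoffel_eq hu, dualFrame, sum_inner, real_inner_smul_left]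
  simp_rw [Finset.sum_mul, ← H.metric_eq u hu]
  rw [Finset.sum_comm, sub_eq_zero]
  have := Matrix.mul_nonsing_inv (h u) (H.isUnit_det u hu)
  have h1 : ∀ q, ∑ l, (h u)⁻¹ l q * inner ℝ (pd q F u) (pd i (pd k F) u) * h u m l
      = if m = q then inner ℝ (pd q F u) (pd i (pd k F) u) else 0 := by
    intro q
    have := congrFun (congrFun this m) q
    rw [Matrix.mul_apply, Matrix.one_apply] at this
    calc _ = (∑ l, h u m l * (h u)⁻¹ l q) * inner ℝ (pd q F u) (pd i (pd k F) u) := by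
          rw [Finset.sum_mul]; exact Finset.sum_congr rfl fun _ _ => by ring
      _ = _ := by rw [this]; split_ifs <;> simp
  simp_rw [h1]
  simp

/-- In the derivative of `Σ hⁱᵐ ∂ₘF` the terms with differentiated `hⁱᵐ` are tangential, so they
disappear against a normal vector; of `∂ⱼ∂ₘF` only the normal part survives. -/
lemma inner_pd_dualFrame_normalPart (i j p q : Fin d) :
    inner ℝ (pd j (dualFrame h F i) u) (normalPart h F p q u)
      = ∑ m, (h u)⁻¹ i m * inner ℝ (normalPart h F j m u) (normalPart h F p q u) := by
  have hd : pd j (dualFrame h F i) u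
      = ∑ m, (pd j (fun y => (h y)⁻¹ i m) u • pd m F u + (h u)⁻¹ i m • pd j (pd m F) u) := by
    have := pd_sum Finset.univ (f := fun m y => (h y)⁻¹ i m • pd m F y) (x := u)
      (fun m _ => (H.differentiableAt hu (H.contDiffOn_inv i m)).smul
        (H.differentiableAt hu (H.contDiffOn_pd m))) j
    refine this.trans (Finset.sum_congr rfl fun m _ => ?_)
    exact pd_smul (H.differentiableAt hu (H.contDiffOn_inv i m))
        (H.differentiableAt hu (H.contDiffOn_pd m)) j
  have hN : ∀ m, inner ℝ (pd j (pd m F) u) (normalPart h F p q u)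
      = inner ℝ (normalPart h F j m u) (normalPart h F p q u) := by
    intro m
    conv_rhs => rw [normalPart, inner_sub_left, sum_inner]
    simp [real_inner_smul_left, H.inner_pd_normalPart hu]
  rw [hd, sum_inner]
  simp [inner_add_left, real_inner_smul_left, H.inner_pd_normalPart hu, hN]

/-- Splitting `∂ₚ∂_qF` into normal and tangential parts separates the extrinsic curvature terms from
the products of Christoffel symbols. -/
lemma inner_pd_dualFrame_pd_pd (i j p q : Fin d) :
    inner ℝ (pd j (dualFrame h F i) u) (pd p (pd q F) u)
      = ∑ m, (h u)⁻¹ i m * inner ℝ (normalPart h F j m u) (normalPart h F p q u)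
        - ∑ l, christoffel h i j l u * christoffel h l p q u := by
  have : pd p (pd q F) u
      = normalPart h F p q u + ∑ l, christoffel h l p q u • pd l F u := by simp [normalPart]
  rw [this, inner_add_right, H.inner_pd_dualFrame_normalPart hu, inner_sum]
  simp_rw [real_inner_smul_right, H.inner_pd_dualFrame hu]
  rw [sub_eq_add_neg, ← Finset.sum_neg_distrib]
  congr 1
  exact Finset.sum_congr rfl fun _ _ => by ring

end IsIsometricImmersionOn

end Gauss

/-! ### The Gauss equation in the sense of distributions -/

section Distribution

variable {d : ℕ} {V : Type*} [NormedAddCommGroup V] [InnerProductSpace ℝ V]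

lemma integrable_of_continuousOn_of_support_subset {D : Type*} [NormedAddCommGroup D]
    [MeasurableSpace D] [BorelSpace D] {μ : Measure D} [IsFiniteMeasureOnCompacts μ]
    {K : Set D} (hK : IsCompact K) {f : D → ℝ} (hf : ContinuousOn f K)
    (hs : Function.support f ⊆ K) : Integrable f μ :=
  (integrableOn_iff_integrable_of_support_subset hs).1 (hf.integrableOn_compact hK)

/-- The integrand which defines the scalar curvature of `h` in the sense of distributions. -/
def scalarIntegrand (h : MetricField d) (ψ : E d → ℝ) (u : E d) : ℝ :=
  ∑ j, ∑ k,
    ((∑ i, (-(pd i (fun y => ψ y * (h y)⁻¹ j k) u * christoffel h i j k u)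
        + pd j (fun y => ψ y * (h y)⁻¹ j k) u * christoffel h i i k u))
      + ψ u * (h u)⁻¹ j k *
        ∑ i, ∑ l, (christoffel h i i l u * christoffel h l j k u
          - christoffel h i j l u * christoffel h l i k u))

/-- The vector field `ψ hʲᵏ Fⁱ` whose distributional mixed partial derivatives enter the Gauss
equation. -/
def weightedDual (h : MetricField d) (F : E d → V) (ψ : E d → ℝ) (j k i : Fin d) (y : E d) : V :=
  (ψ y * (h y)⁻¹ j k) • dualFrame h F i y

lemma pd_eq_zero_of_notMem_tsupport {W : Type*} [NormedAddCommGroup W] [NormedSpace ℝ W]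
    {f : E d → W} {u : E d} (hu : u ∉ tsupport f) (i : Fin d) : pd i f u = 0 := by
  have : fderiv ℝ f u = 0 := by
    by_contra h
    exact hu (support_fderiv_subset ℝ h)
  simp [pd, this]

lemma tsupport_weightedDual_subset (h : MetricField d) (F : E d → V) (ψ : E d → ℝ)
    (j k i : Fin d) : tsupport (weightedDual h F ψ j k i) ⊆ tsupport ψ := by
  refine closure_mono fun y hy hψ => hy ?_
  simp [weightedDual, hψ]

namespace IsIsometricImmersionOn

variable {h : MetricField d} {F : E d → V} {U : Set (E d)} (H : IsIsometricImmersionOn h F U)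

include H

/-- Apply the product rule to `X = (ψ hʲᵏ) Fⁱ`. The derivative of the weight gives the weak
derivatives of `Γ`; the derivative of `Fⁱ` gives the products of Christoffel symbols up to the
extrinsic curvature. -/
lemma scalarIntegrand_eq {ψ : E d → ℝ} (hψ : ContDiff ℝ ∞ ψ) (hψU : tsupport ψ ⊆ U) (u : E d) :
    scalarIntegrand h ψ u = ψ u * gaussScalar h F u + ∑ j, ∑ k, ∑ i,
      (inner ℝ (pd j (weightedDual h F ψ j k i) u) (pd i (pd k F) u)
        - inner ℝ (pd i (weightedDual h F ψ j k i) u) (pd j (pd k F) u)) := by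
  -- One summand for fixed `j, k, i`: `a`, `b` are the derivatives of the weight in directions `i`,
  -- `j`; `c`, `e` are `Γⁱⱼₖ`, `Γⁱᵢₖ`; `f₁`, `f₂` are products of Christoffel symbols; `g` is `hⁱᵐ`;
  -- `n₁`, `n₂` are inner products of normal parts.
  have alg : ∀ (p q a b c e : ℝ) (f₁ f₂ g n₁ n₂ : Fin d → ℝ),
      (-(a * c) + b * e) + p * q * ∑ l, (f₁ l - f₂ l)
        = p * ∑ m, q * g m * (n₁ m - n₂ m)
          + ((b * e + p * q * (∑ m, g m * n₂ m - ∑ l, f₂ l))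
            - (a * c + p * q * (∑ m, g m * n₁ m - ∑ l, f₁ l))) := by
    intro p q a b c e f₁ f₂ g n₁ n₂
    simp_rw [mul_sub, Finset.sum_sub_distrib, mul_assoc, ← Finset.mul_sum, mul_sub]
    ring
  by_cases hu' : u ∈ tsupport ψ
  · have hu : u ∈ U := hψU hu'
    have hw : ∀ j k, DifferentiableAt ℝ (fun y => ψ y * (h y)⁻¹ j k) u := fun j k =>
      ((hψ.differentiable (by simp)) u).mul (H.differentiableAt hu (H.contDiffOn_inv j k))
    have hX : ∀ j k i a, pd a (weightedDual h F ψ j k i) u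
        = pd a (fun y => ψ y * (h y)⁻¹ j k) u • dualFrame h F i u
          + (ψ u * (h u)⁻¹ j k) • pd a (dualFrame h F i) u := fun j k i a =>
      pd_smul (hw j k) (H.differentiableAt hu (H.contDiffOn_dualFrame i)) a
    simp_rw [hX, inner_add_left, real_inner_smul_left, H.inner_pd_dualFrame_pd_pd hu,
      ← H.christoffel_eq hu]
    rw [scalarIntegrand, gaussScalar, Finset.mul_sum, ← Finset.sum_add_distrib]
    refine Finset.sum_congr rfl fun j _ => ?_
    rw [Finset.mul_sum, ← Finset.sum_add_distrib]
    refine Finset.sum_congr rfl fun k _ => ?_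
    rw [Finset.mul_sum, Finset.mul_sum, ← Finset.sum_add_distrib, ← Finset.sum_add_distrib]
    refine Finset.sum_congr rfl fun i _ => ?_
    exact alg _ _ _ _ _ _ _ _ _ _ _
  -- Nothing is known about `F` outside `U`, but there every term carries `ψ` or a derivative of a
  -- multiple of `ψ`.
  · have h1 : ∀ j k a, pd a (fun y => ψ y * (h y)⁻¹ j k) u = 0 := fun j k a =>
      pd_eq_zero_of_notMem_tsupport (fun h' => hu' (tsupport_mul_subset_left h')) a
    have h2 : ∀ j k i a, pd a (weightedDual h F ψ j k i) u = 0 := fun j k i a =>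
      pd_eq_zero_of_notMem_tsupport (fun h' => hu' (tsupport_weightedDual_subset h F ψ j k i h')) a
    have h3 : ψ u = 0 := image_eq_zero_of_notMem_tsupport hu'
    simp [scalarIntegrand, h1, h2, h3]

lemma continuousOn_pd_pd (j k : Fin d) : ContinuousOn (pd j (pd k F)) U :=
  (SphereHypersurface.contDiffOn_pd (m := 0) H.isOpen (H.contDiffOn_pd k) (by norm_num)
    j).continuousOn

lemma continuousOn_christoffel (l i k : Fin d) : ContinuousOn (christoffel h l i k) U := by
  refine ContinuousOn.congr (f := fun u => inner ℝ (dualFrame h F l u) (pd i (pd k F) u)) ?_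
    fun u hu => H.christoffel_eq hu l i k
  exact (H.contDiffOn_dualFrame l).continuousOn.inner (H.continuousOn_pd_pd i k)

lemma continuousOn_normalPart (i k : Fin d) : ContinuousOn (normalPart h F i k) U :=
  (H.continuousOn_pd_pd i k).sub (continuousOn_finsetSum _ fun l _ =>
    (H.continuousOn_christoffel l i k).smul (H.contDiffOn_pd l).continuousOn)

lemma continuousOn_gaussScalar : ContinuousOn (gaussScalar h F) U := by
  refine continuousOn_finsetSum _ fun j _ => continuousOn_finsetSum _ fun k _ =>
    continuousOn_finsetSum _ fun i _ => continuousOn_finsetSum _ fun m _ => ?_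
  exact ((H.contDiffOn_inv j k).continuousOn.mul (H.contDiffOn_inv i m).continuousOn).mul
    (((H.continuousOn_normalPart i m).inner (H.continuousOn_normalPart j k)).sub
      ((H.continuousOn_normalPart j m).inner (H.continuousOn_normalPart i k)))

lemma contDiff_weightedDual {ψ : E d → ℝ} (hψ : ContDiff ℝ ∞ ψ) (hψU : tsupport ψ ⊆ U)
    (j k i : Fin d) : ContDiff ℝ 1 (weightedDual h F ψ j k i) := by
  refine contDiff_of_tsupport_subset H.isOpen ?_
    ((tsupport_weightedDual_subset h F ψ j k i).trans hψU)
  exact ((hψ.of_le (by norm_cast)).contDiffOn.mul (H.contDiffOn_inv j k)).smul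
    (H.contDiffOn_dualFrame i)

/-- The distributional Gauss equation for `C²` immersions into a Euclidean space. -/
theorem integral_scalarIntegrand [FiniteDimensional ℝ V] {ψ : E d → ℝ} (hψ : ContDiff ℝ ∞ ψ)
    (hψc : HasCompactSupport ψ) (hψU : tsupport ψ ⊆ U) :
    ∫ u, scalarIntegrand h ψ u = ∫ u, gaussScalar h F u * ψ u := by
  have hXi : ∀ j k i a b, Integrable fun u =>
      inner ℝ (pd a (weightedDual h F ψ j k i) u) (pd b (pd k F) u) := by
    intro j k i a b
    refine integrable_of_continuousOn_of_support_subset hψc ?_ fun u hu => ?_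
    · refine ContinuousOn.inner (Continuous.continuousOn ?_)
        ((H.continuousOn_pd_pd b k).mono hψU)
      exact ((H.contDiff_weightedDual hψ hψU j k i).continuous_fderiv one_ne_zero).clm_apply
        continuous_const
    · by_contra hn
      refine hu ?_
      simp only [pd_eq_zero_of_notMem_tsupport (fun h' =>
        hn (tsupport_weightedDual_subset h F ψ j k i h')) a, inner_zero_left]
  have hG : Integrable fun u => ψ u * gaussScalar h F u := by
    refine integrable_of_continuousOn_of_support_subset hψc
      (hψ.continuous.continuousOn.mul (H.continuousOn_gaussScalar.mono hψU)) fun u hu => ?_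
    exact subset_tsupport _ (left_ne_zero_of_mul hu)
  have hXd : ∀ j k i, Integrable fun u =>
      inner ℝ (pd j (weightedDual h F ψ j k i) u) (pd i (pd k F) u)
        - inner ℝ (pd i (weightedDual h F ψ j k i) u) (pd j (pd k F) u) :=
    fun j k i => (hXi j k i j i).sub (hXi j k i i j)
  have hsum : Integrable fun u => ∑ j, ∑ k, ∑ i,
      (inner ℝ (pd j (weightedDual h F ψ j k i) u) (pd i (pd k F) u)
        - inner ℝ (pd i (weightedDual h F ψ j k i) u) (pd j (pd k F) u)) :=
    integrable_finsetSum _ fun j _ => integrable_finsetSum _ fun k _ =>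
      integrable_finsetSum _ fun i _ => hXd j k i
  simp_rw [H.scalarIntegrand_eq hψ hψU]
  rw [integral_add hG hsum, integral_finsetSum _ fun j _ => integrable_finsetSum _ fun k _ =>
      integrable_finsetSum _ fun i _ => hXd j k i]
  have hz : ∀ j, ∫ u, ∑ k, ∑ i,
      (inner ℝ (pd j (weightedDual h F ψ j k i) u) (pd i (pd k F) u)
        - inner ℝ (pd i (weightedDual h F ψ j k i) u) (pd j (pd k F) u)) = 0 := by
    intro j
    rw [integral_finsetSum _ fun k _ =>
      integrable_finsetSum _ fun i _ => hXd j k i]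
    refine Finset.sum_eq_zero fun k _ => ?_
    rw [integral_finsetSum _ fun i _ => hXd j k i]
    refine Finset.sum_eq_zero fun i _ => ?_
    rw [integral_sub (hXi j k i j i) (hXi j k i i j), sub_eq_zero]
    -- Weak derivatives commute on the `C¹` map `∂ₖF`; this replaces the third derivatives of `F` in
    -- the classical proof.
    refine integral_inner_fderiv_comm_of_contDiffOn volume H.isOpen
      (H.contDiff_weightedDual hψ hψU j k i)
      (hψc.of_isClosed_subset (isClosed_tsupport _) (tsupport_weightedDual_subset h F ψ j k i))
      ((tsupport_weightedDual_subset h F ψ j k i).trans hψU) (H.contDiffOn_pd k) _ _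
  simp_rw [hz, mul_comm (ψ _)]
  simp

/-- The scalar curvature in the sense of distributions is given by the Gauss equation. -/
theorem eqOn_gaussScalar [FiniteDimensional ℝ V] {R : E d → ℝ} (hR : IsScalarCurvatureOn h U R) :
    Set.EqOn R (gaussScalar h F) U := by
  have hc : ContinuousOn (fun u => R u - gaussScalar h F u) U :=
    hR.1.sub H.continuousOn_gaussScalar
  have hint : ∀ {f ψ : E d → ℝ}, ContinuousOn f U → ContDiff ℝ ∞ ψ → HasCompactSupport ψ →
      tsupport ψ ⊆ U → Integrable fun u => f u * ψ u := by
    intro f ψ hf hψ hψc hψU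
    refine integrable_of_continuousOn_of_support_subset hψc
      ((hf.mono hψU).mul hψ.continuous.continuousOn) fun u hu => ?_
    exact subset_tsupport _ (right_ne_zero_of_mul hu)
  have hae := H.isOpen.ae_eq_zero_of_integral_contDiff_smul_eq_zero (μ := volume)
    (hc.locallyIntegrableOn H.isOpen.measurableSet) (by
      intro ψ hψ hψc hψU
      have h1 : ∫ u, R u * ψ u = ∫ u, scalarIntegrand h ψ u := hR.2 ψ hψ hψc hψU
      rw [H.integral_scalarIntegrand hψ hψc hψU] at h1
      simp_rw [smul_eq_mul, mul_sub, mul_comm (ψ _)]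
      rw [integral_sub (hint hR.1 hψ hψc hψU) (hint H.continuousOn_gaussScalar hψ hψc hψU), h1,
        sub_self])
  -- Both sides are continuous, so equality almost everywhere on the open set is equality everywhere
  -- on it.
  refine Measure.eqOn_open_of_ae_eq (μ := volume) ?_ H.isOpen hR.1 H.continuousOn_gaussScalar
  rw [EventuallyEq, ae_restrict_iff' H.isOpen.measurableSet]
  filter_upwards [hae] with u hu hU
  exact sub_eq_zero.1 (hu hU)

end IsIsometricImmersionOn

end Distribution

/-! ### Christoffel symbols and second fundamental forms of the conformally flat metrics -/

section ConformallyFlat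

variable {d m : ℕ}

lemma inner_eq_sum (x y : E m) : inner ℝ x y = ∑ a, x a * y a := by
  simp [PiLp.inner_apply, mul_comm]

lemma inducedMetric_smul_one {g : MetricField m} {c : E m → ℝ} (hg : ∀ x, g x = c x • 1)
    (F : E d → E m) (u : E d) (i j : Fin d) :
    inducedMetric g F u i j = c (F u) * inner ℝ (pd i F u) (pd j F u) := by
  simp [inducedMetric, hg, Matrix.one_apply, inner_eq_sum, Finset.mul_sum, mul_assoc]

lemma pd_comp_eq {f : E m → ℝ} {f' : ℝ} {i : Fin m} {x : E m} (g : ℝ → ℝ) {g' : ℝ}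
    (hf : DifferentiableAt ℝ f x) (hf' : pd i f x = f') (hg : HasDerivAt g g' (f x)) :
    pd i (fun y => g (f y)) x = g' * f' := by
  have := (hg.comp_hasFDerivAt x hf.hasFDerivAt).fderiv
  rw [pd, show (fun y => g (f y)) = g ∘ f from rfl, this, ← hf']
  rfl

lemma pd_apply {f : E d → E m} {x : E d} (hf : DifferentiableAt ℝ f x) (i : Fin d) (k : Fin m) :
    pd i (fun y => f y k) x = pd i f x k := by
  have := ((EuclideanSpace.proj (𝕜 := ℝ) k).hasFDerivAt.comp x hf.hasFDerivAt).fderiv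
  rw [pd, show (fun y => f y k) = (EuclideanSpace.proj (𝕜 := ℝ) k) ∘ f from rfl, this]
  rfl

lemma pd_quadratic (a : ℝ) (i : Fin m) (x : E m) :
    pd i (fun y : E m => (a + ‖y‖ ^ 2) / 2) x = x i := by
  have h : HasFDerivAt (fun y : E m => (a + ‖y‖ ^ 2) / 2) (innerSL ℝ x) x := by
    have := ((hasStrictFDerivAt_norm_sq x).hasFDerivAt.const_add a).mul_const (1 / 2 : ℝ)
    refine (this.congr_fderiv ?_).congr_of_eventuallyEq ?_
    · ext v; simp
    · exact Eventually.of_forall fun y => by ring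
  rw [pd, h.fderiv]
  simp [EuclideanSpace.inner_single_right]

variable {g : MetricField m} {a : ℝ}

/-- The parameter `a` serves both ambient metrics: `a = 1` is the round metric, `a = 1 + ε²` its
restriction to the hyperplane at height `ε`. -/
lemma christoffel_conformal (ha : 0 < a)
    (hg : ∀ x, g x = (((a + ‖x‖ ^ 2) / 2) ^ 2)⁻¹ • (1 : Matrix (Fin m) (Fin m) ℝ))
    (k i j : Fin m) (x : E m) :
    christoffel g k i j x = -((a + ‖x‖ ^ 2) / 2)⁻¹ *
      (x i * (1 : Matrix (Fin m) (Fin m) ℝ) j k + x j * (1 : Matrix (Fin m) (Fin m) ℝ) i k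
        - x k * (1 : Matrix (Fin m) (Fin m) ℝ) i j) := by
  have hf : 0 < (a + ‖x‖ ^ 2) / 2 := by positivity
  have hd : ∀ i j l, pd i (fun y => g y j l) x
      = -2 * (((a + ‖x‖ ^ 2) / 2) ^ 3)⁻¹ * x i * (1 : Matrix (Fin m) (Fin m) ℝ) j l := by
    intro i j l
    simp_rw [hg, Matrix.smul_apply, smul_eq_mul]
    have hdiff : DifferentiableAt ℝ (fun y : E m => (a + ‖y‖ ^ 2) / 2) x :=
      by
      have h0 : DifferentiableAt ℝ (fun y : E m => y) x := differentiableAt_fun_id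
      simp_rw [div_eq_mul_inv]
      exact ((h0.norm_sq ℝ).const_add a).mul_const _
    have h1 : HasDerivAt (fun t : ℝ => (t ^ 2)⁻¹ * (1 : Matrix (Fin m) (Fin m) ℝ) j l)
        (-(2 * ((a + ‖x‖ ^ 2) / 2)) / (((a + ‖x‖ ^ 2) / 2) ^ 2) ^ 2
          * (1 : Matrix (Fin m) (Fin m) ℝ) j l) ((a + ‖x‖ ^ 2) / 2) := by
      refine HasDerivAt.mul_const (HasDerivAt.inv ?_ (by positivity)) _
      simpa using hasDerivAt_pow 2 ((a + ‖x‖ ^ 2) / 2)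
    rw [pd_comp_eq _ hdiff (pd_quadratic a i x) h1]
    field_simp
  have hinv : (g x)⁻¹ = ((a + ‖x‖ ^ 2) / 2) ^ 2 • (1 : Matrix (Fin m) (Fin m) ℝ) := by
    refine Matrix.inv_eq_right_inv ?_
    rw [hg, Matrix.smul_mul, Matrix.mul_smul, smul_smul, inv_mul_cancel₀ (by positivity),
      one_smul, one_mul]
  rw [christoffel, Finset.sum_eq_single k]
  · simp_rw [hd, hinv]
    rw [Matrix.smul_apply, Matrix.one_apply_eq, smul_eq_mul]
    field_simp
    ring
  · intro l _ hl
    rw [hinv, Matrix.smul_apply, Matrix.one_apply_ne hl.symm]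
    simp
  · simp

/-- Of the three terms in the conformal Christoffel symbols, two are tangent to `F` and vanish
against `ν`; the third contributes the multiple of the metric. -/
lemma secondForm_conformal (ha : 0 < a)
    (hg : ∀ x, g x = (((a + ‖x‖ ^ 2) / 2) ^ 2)⁻¹ • (1 : Matrix (Fin m) (Fin m) ℝ))
    {F : E d → E m} {ν : E m} {u : E d} (hν : ∀ i, inner ℝ ν (pd i F u) = 0) (i j : Fin d) :
    secondForm g F (((a + ‖F u‖ ^ 2) / 2) • ν) u i j
      = ((a + ‖F u‖ ^ 2) / 2)⁻¹ * inner ℝ ν (pd i (pd j F) u)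
        + (((a + ‖F u‖ ^ 2) / 2) ^ 2)⁻¹ * inner ℝ (pd i F u) (pd j F u) * inner ℝ ν (F u) := by
  have hf : 0 < (a + ‖F u‖ ^ 2) / 2 := by positivity
  have hcov : ∀ b, covFrame g F i j u b = pd i (pd j F) u b
      - ((a + ‖F u‖ ^ 2) / 2)⁻¹ * (inner ℝ (F u) (pd i F u) * pd j F u b
        + inner ℝ (F u) (pd j F u) * pd i F u b
        - F u b * inner ℝ (pd i F u) (pd j F u)) := by
    intro b
    rw [covFrame, sub_eq_add_neg]
    congr 1
    simp_rw [christoffel_conformal ha hg, inner_eq_sum, mul_assoc, ← Finset.mul_sum]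
    rw [neg_mul]
    congr 2
    simp_rw [sub_mul, add_mul, Finset.sum_sub_distrib, Finset.sum_add_distrib, Matrix.one_apply]
    congr 1
    · congr 1
      · rw [Finset.sum_mul]
        refine Finset.sum_congr rfl fun c _ => ?_
        simp
        ring
      · rw [Finset.sum_comm, Finset.sum_mul]
        refine Finset.sum_congr rfl fun c _ => ?_
        simp
        ring
    · rw [Finset.mul_sum]
      refine Finset.sum_congr rfl fun c _ => ?_
      simp
  have h1 : secondForm g F (((a + ‖F u‖ ^ 2) / 2) • ν) u i j
      = ((a + ‖F u‖ ^ 2) / 2)⁻¹ * ∑ b, ν b * covFrame g F i j u b := by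
    rw [secondForm, Matrix.of_apply, Finset.mul_sum]
    refine Finset.sum_congr rfl fun b _ => ?_
    rw [Finset.sum_eq_single b]
    · rw [hg, Matrix.smul_apply, Matrix.one_apply_eq]
      simp only [PiLp.smul_apply, smul_eq_mul]
      field_simp
    · intro c _ hc
      rw [hg, Matrix.smul_apply, Matrix.one_apply_ne hc.symm]
      simp
    · simp
  have h2 : ∑ b, ν b * covFrame g F i j u b = inner ℝ ν (pd i (pd j F) u)
      - ((a + ‖F u‖ ^ 2) / 2)⁻¹ * (inner ℝ (F u) (pd i F u) * inner ℝ ν (pd j F u)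
        + inner ℝ (F u) (pd j F u) * inner ℝ ν (pd i F u)
        - inner ℝ ν (F u) * inner ℝ (pd i F u) (pd j F u)) := by
    simp_rw [hcov]
    generalize inner ℝ (F u) (pd i F u) = α
    generalize inner ℝ (F u) (pd j F u) = β
    generalize inner ℝ (pd i F u) (pd j F u) = γ
    simp_rw [inner_eq_sum, Finset.mul_sum, Finset.sum_mul, ← Finset.sum_add_distrib,
      ← Finset.sum_sub_distrib, Finset.mul_sum, ← Finset.sum_sub_distrib]
    exact Finset.sum_congr rfl fun b _ => by ring
  rw [h1, h2, hν, hν]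
  field_simp
  ring

lemma conf_eq (x : E m) : conf x = (1 + ‖x‖ ^ 2) / 2 := by
  rw [conf, EuclideanSpace.real_norm_sq_eq]

lemma roundMetric_eq (x : E m) :
    roundMetric m x = (((1 + ‖x‖ ^ 2) / 2) ^ 2)⁻¹ • (1 : Matrix (Fin m) (Fin m) ℝ) := by
  rw [roundMetric, conf_eq]

end ConformallyFlat

/-! ### Inverse stereographic projection of an immersion -/

section SphereLift

variable {d m : ℕ}

/-- The composition of `F` with the inverse stereographic projection, which is an isometry of
`(ℝᵐ, g_S)` into the unit sphere of `ℝᵐ × ℝ`. -/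
def sphereLift (F : E d → E m) (u : E d) : WithLp 2 (E m × ℝ) :=
  WithLp.toLp 2 ((conf (F u))⁻¹ • F u, 1 - (conf (F u))⁻¹)

/-- The image of the vector `conf x • ν` at `x` under the inverse stereographic projection. -/
def normalLift (x ν : E m) : WithLp 2 (E m × ℝ) :=
  WithLp.toLp 2 (ν - ((conf x)⁻¹ * inner ℝ ν x) • x, (conf x)⁻¹ * inner ℝ ν x)

lemma conf_pos (x : E m) : 0 < conf x := by
  rw [conf_eq]; positivity

/-- This relation drives the inner product computations for the lift: in each of them the two sides
differ by a multiple of it. -/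
lemma conf_inv_mul_norm_sq (x : E m) : (conf x)⁻¹ * (inner ℝ x x + 1) = 2 := by
  have := conf_pos x
  rw [inv_mul_eq_iff_eq_mul₀ this.ne', conf_eq, real_inner_self_eq_norm_sq]
  ring

lemma pd_toLp {V W : Type*} [NormedAddCommGroup V] [InnerProductSpace ℝ V] [NormedAddCommGroup W]
    [InnerProductSpace ℝ W] {f : E d → V} {g : E d → W} {u : E d} (hf : DifferentiableAt ℝ f u)
    (hg : DifferentiableAt ℝ g u) (i : Fin d) :
    pd i (fun y => WithLp.toLp 2 (f y, g y)) u = WithLp.toLp 2 (pd i f u, pd i g u) := by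
  have := ((WithLp.prodContinuousLinearEquiv 2 ℝ V W).symm.hasFDerivAt.comp u
    (hf.hasFDerivAt.prodMk hg.hasFDerivAt)).fderiv
  rw [pd, show (fun y => WithLp.toLp 2 (f y, g y))
    = (WithLp.prodContinuousLinearEquiv 2 ℝ V W).symm ∘ fun y => (f y, g y) from rfl, this]
  rfl

lemma contDiffOn_toLp {V W : Type*} [NormedAddCommGroup V] [InnerProductSpace ℝ V]
    [NormedAddCommGroup W] [InnerProductSpace ℝ W] {f : E d → V} {g : E d → W} {U : Set (E d)}
    {n : ℕ∞ω} (hf : ContDiffOn ℝ n f U) (hg : ContDiffOn ℝ n g U) :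
    ContDiffOn ℝ n (fun y => WithLp.toLp 2 (f y, g y)) U :=
  (WithLp.prodContinuousLinearEquiv 2 ℝ V W).symm.contDiff.comp_contDiffOn (hf.prodMk hg)

variable {F : E d → E m} {U : Set (E d)}

lemma contDiffOn_conf_inv {n : ℕ∞ω} (hF : ContDiffOn ℝ n F U) :
    ContDiffOn ℝ n (fun y => (conf (F y))⁻¹) U := by
  simp_rw [conf_eq]
  refine ContDiffOn.inv ?_ fun u _ => by positivity
  exact (contDiffOn_const.add (hF.norm_sq ℝ)).div_const 2

lemma contDiffOn_sphereLift {n : ℕ∞ω} (hF : ContDiffOn ℝ n F U) :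
    ContDiffOn ℝ n (sphereLift F) U :=
  contDiffOn_toLp ((contDiffOn_conf_inv hF).smul hF)
    (contDiffOn_const.sub (contDiffOn_conf_inv hF))

lemma pd_conf_inv {u : E d} (hF : DifferentiableAt ℝ F u) (i : Fin d) :
    pd i (fun y => (conf (F y))⁻¹) u = -((conf (F u))⁻¹) ^ 2 * inner ℝ (F u) (pd i F u) := by
  have h1 := (hF.hasFDerivAt.norm_sq.const_add 1).mul_const (1 / 2 : ℝ)
  have h2 : HasFDerivAt (fun y => conf (F y)) _ u :=
    h1.congr_of_eventuallyEq (Eventually.of_forall fun y => by simp only [conf_eq]; ring)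
  have h3 := ((hasDerivAt_inv (conf_pos (F u)).ne').comp_hasFDerivAt u h2).fderiv
  rw [pd, show (fun y => (conf (F y))⁻¹) = Inv.inv ∘ (fun y => conf (F y)) from rfl, h3]
  simp [pd]

lemma differentiableAt_conf_inv {u : E d} (hF : DifferentiableAt ℝ F u) :
    DifferentiableAt ℝ (fun y => (conf (F y))⁻¹) u := by
  simp_rw [conf_eq]
  refine DifferentiableAt.fun_inv ?_ (by positivity)
  simp_rw [div_eq_mul_inv]
  exact ((hF.norm_sq ℝ).const_add (1 : ℝ)).mul_const _

lemma pd_sphereLift {u : E d} (hF : DifferentiableAt ℝ F u) (i : Fin d) :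
    pd i (sphereLift F) u = WithLp.toLp 2
      ((-((conf (F u))⁻¹) ^ 2 * inner ℝ (F u) (pd i F u)) • F u + (conf (F u))⁻¹ • pd i F u,
        ((conf (F u))⁻¹) ^ 2 * inner ℝ (F u) (pd i F u)) := by
  have hp := differentiableAt_conf_inv hF
  rw [show sphereLift F = fun u => WithLp.toLp 2 ((conf (F u))⁻¹ • F u, 1 - (conf (F u))⁻¹)
    from rfl, pd_toLp (hp.fun_smul hF) (hp.const_sub 1), pd_smul hp hF, pd_conf_inv hF]
  congr 2
  rw [pd, fderiv_const_sub]
  have := pd_conf_inv hF i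
  rw [pd] at this
  simp [this]

lemma inner_pd_sphereLift {u : E d} (hF : DifferentiableAt ℝ F u) (i j : Fin d) :
    inner ℝ (pd i (sphereLift F) u) (pd j (sphereLift F) u)
      = ((conf (F u))⁻¹) ^ 2 * inner ℝ (pd i F u) (pd j F u) := by
  rw [pd_sphereLift hF, pd_sphereLift hF, WithLp.prod_inner_apply]
  simp only [inner_add_left, inner_add_right, real_inner_smul_left, real_inner_smul_right,
    real_inner_comm (F u) (pd i F u), RCLike.inner_apply, conj_trivial]
  have h := conf_inv_mul_norm_sq (F u)
  linear_combination (((conf (F u))⁻¹) ^ 3 * inner ℝ (F u) (pd i F u)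
    * inner ℝ (F u) (pd j F u)) * h

lemma inner_sphereLift_self (u : E d) : inner ℝ (sphereLift F u) (sphereLift F u) = 1 := by
  rw [sphereLift, WithLp.prod_inner_apply]
  simp only [real_inner_smul_left, real_inner_smul_right, RCLike.inner_apply, conj_trivial]
  linear_combination (conf (F u))⁻¹ * conf_inv_mul_norm_sq (F u)

lemma inner_sphereLift_pd {u : E d} (hF : DifferentiableAt ℝ F u) (i : Fin d) :
    inner ℝ (sphereLift F u) (pd i (sphereLift F) u) = 0 := by
  rw [pd_sphereLift hF, sphereLift, WithLp.prod_inner_apply]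
  simp only [inner_add_right, real_inner_smul_left, real_inner_smul_right, RCLike.inner_apply,
    conj_trivial]
  linear_combination (-((conf (F u))⁻¹) ^ 2 * inner ℝ (F u) (pd i F u))
    * conf_inv_mul_norm_sq (F u)

lemma inner_normalLift_self {x ν : E m} (hν : ‖ν‖ = 1) :
    inner ℝ (normalLift x ν) (normalLift x ν) = 1 := by
  have h1 : inner ℝ ν ν = (1 : ℝ) := by rw [real_inner_self_eq_norm_sq, hν, one_pow]
  rw [normalLift, WithLp.prod_inner_apply]
  simp only [inner_sub_left, inner_sub_right, real_inner_smul_left, real_inner_smul_right,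
    real_inner_comm ν x, RCLike.inner_apply, conj_trivial, h1]
  linear_combination ((conf x)⁻¹ * inner ℝ ν x ^ 2) * conf_inv_mul_norm_sq x

lemma inner_normalLift_sphereLift (u : E d) (ν : E m) :
    inner ℝ (normalLift (F u) ν) (sphereLift F u) = 0 := by
  rw [normalLift, sphereLift, WithLp.prod_inner_apply]
  simp only [inner_sub_left, real_inner_smul_left, real_inner_smul_right,
    RCLike.inner_apply, conj_trivial]
  linear_combination (-(conf (F u))⁻¹ * inner ℝ ν (F u)) * conf_inv_mul_norm_sq (F u)

lemma inner_normalLift_pd {u : E d} (hF : DifferentiableAt ℝ F u) {ν : E m} (i : Fin d)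
    (hν : inner ℝ ν (pd i F u) = 0) :
    inner ℝ (normalLift (F u) ν) (pd i (sphereLift F) u) = 0 := by
  rw [normalLift, pd_sphereLift hF, WithLp.prod_inner_apply]
  simp only [inner_sub_left, inner_add_right, real_inner_smul_left, real_inner_smul_right,
    RCLike.inner_apply, conj_trivial, hν]
  linear_combination (((conf (F u))⁻¹) ^ 2 * inner ℝ ν (F u) * inner ℝ (F u) (pd i F u))
    * conf_inv_mul_norm_sq (F u)

/-- The number `q` is `∂ᵢ∂ⱼ(φ⁻¹)`, and the last coordinate of the lift is `1 - φ⁻¹`, whence `-q`.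
Naming it lets the later computations treat it as one unknown. -/
lemma pd_pd_sphereLift (hU : IsOpen U) (hF : ContDiffOn ℝ 2 F U) {u : E d} (hu : u ∈ U)
    (i j : Fin d) :
    ∃ q : ℝ, q = -2 * (conf (F u))⁻¹ * (-((conf (F u))⁻¹) ^ 2 * inner ℝ (F u) (pd i F u))
        * inner ℝ (F u) (pd j F u)
        - ((conf (F u))⁻¹) ^ 2 *
          (inner ℝ (pd i F u) (pd j F u) + inner ℝ (F u) (pd i (pd j F) u)) ∧
    pd i (pd j (sphereLift F)) u = WithLp.toLp 2
      (q • F u + (-((conf (F u))⁻¹) ^ 2 * inner ℝ (F u) (pd j F u)) • pd i F u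
        + ((-((conf (F u))⁻¹) ^ 2 * inner ℝ (F u) (pd i F u)) • pd j F u
          + (conf (F u))⁻¹ • pd i (pd j F) u), -q) := by
  refine ⟨_, rfl, ?_⟩
  have hd : ∀ v ∈ U, DifferentiableAt ℝ F v := fun v hv =>
    (hF.contDiffAt (hU.mem_nhds hv)).differentiableAt two_ne_zero
  have hdj : DifferentiableAt ℝ (pd j F) u :=
    ((contDiffOn_pd (m := 1) hU hF (by norm_num) j).contDiffAt
      (hU.mem_nhds hu)).differentiableAt one_ne_zero
  have hp := differentiableAt_conf_inv (hd u hu)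
  have hin : DifferentiableAt ℝ (fun y => inner ℝ (F y) (pd j F y)) u := (hd u hu).inner ℝ hdj
  have hp2 : DifferentiableAt ℝ (fun y => ((conf (F y))⁻¹) ^ 2) u := hp.pow 2
  have hr : DifferentiableAt ℝ
      (fun y => ((conf (F y))⁻¹) ^ 2 * inner ℝ (F y) (pd j F y)) u := hp2.mul hin
  have hr' : DifferentiableAt ℝ
      (fun y => -((conf (F y))⁻¹) ^ 2 * inner ℝ (F y) (pd j F y)) u := hp2.neg.mul hin
  have e1 : pd i (fun y => ((conf (F y))⁻¹) ^ 2 * inner ℝ (F y) (pd j F y)) u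
      = 2 * (conf (F u))⁻¹ * (-((conf (F u))⁻¹) ^ 2 * inner ℝ (F u) (pd i F u))
        * inner ℝ (F u) (pd j F u) + ((conf (F u))⁻¹) ^ 2 *
          (inner ℝ (pd i F u) (pd j F u) + inner ℝ (F u) (pd i (pd j F) u)) := by
    have h1 : pd i (fun y => ((conf (F y))⁻¹) ^ 2) u
        = 2 * (conf (F u))⁻¹ * (-((conf (F u))⁻¹) ^ 2 * inner ℝ (F u) (pd i F u)) := by
      refine pd_comp_eq (fun t => t ^ 2) hp (pd_conf_inv (hd u hu) i) ?_
      simpa using hasDerivAt_pow 2 (conf (F u))⁻¹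
    have := pd_smul hp2 hin i
    simp only [smul_eq_mul] at this
    rw [this, h1, pd_inner (hd u hu) hdj]
  have e2 : pd i (fun y => -((conf (F y))⁻¹) ^ 2 * inner ℝ (F y) (pd j F y)) u
      = - pd i (fun y => ((conf (F y))⁻¹) ^ 2 * inner ℝ (F y) (pd j F y)) u := by
    simp_rw [neg_mul]
    rw [pd, fderiv_fun_neg]
    rfl
  have hloc : pd j (sphereLift F) =ᶠ[𝓝 u] fun y => WithLp.toLp 2
      ((-((conf (F y))⁻¹) ^ 2 * inner ℝ (F y) (pd j F y)) • F y + (conf (F y))⁻¹ • pd j F y,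
        ((conf (F y))⁻¹) ^ 2 * inner ℝ (F y) (pd j F y)) := by
    filter_upwards [hU.mem_nhds hu] with y hy using pd_sphereLift (hd y hy) j
  have e3 : pd i (fun y => (-((conf (F y))⁻¹) ^ 2 * inner ℝ (F y) (pd j F y)) • F y
      + (conf (F y))⁻¹ • pd j F y) u
      = pd i (fun y => (-((conf (F y))⁻¹) ^ 2 * inner ℝ (F y) (pd j F y)) • F y) u
        + pd i (fun y => (conf (F y))⁻¹ • pd j F y) u := by
    rw [pd, fderiv_fun_add (hr'.fun_smul (hd u hu)) (hp.fun_smul hdj)]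
    rfl
  rw [pd_congr hloc, pd_toLp ((hr'.fun_smul (hd u hu)).fun_add (hp.fun_smul hdj)) hr, e3,
    pd_smul hr' (hd u hu), pd_smul hp hdj, e2, e1, pd_conf_inv (hd u hu)]
  congr 3
  · congr 2
    ring
  · ring

/-- The right-hand side is that of `secondForm_conformal` with `a = 1`: the lift carries the second
fundamental form in `g_S` to the `normalLift` component of the Euclidean one. -/
lemma inner_normalLift_pd_pd (hU : IsOpen U) (hF : ContDiffOn ℝ 2 F U) {u : E d} (hu : u ∈ U)
    {ν : E m} (hν : ∀ i, inner ℝ ν (pd i F u) = 0) (i j : Fin d) :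
    inner ℝ (normalLift (F u) ν) (pd i (pd j (sphereLift F)) u)
      = (conf (F u))⁻¹ * inner ℝ ν (pd i (pd j F) u)
        + ((conf (F u))⁻¹) ^ 2 * inner ℝ (pd i F u) (pd j F u) * inner ℝ ν (F u) := by
  obtain ⟨q, hq, h⟩ := pd_pd_sphereLift hU hF hu i j
  rw [h, normalLift, WithLp.prod_inner_apply]
  simp only [inner_sub_left, inner_add_right, real_inner_smul_left, real_inner_smul_right,
    RCLike.inner_apply, conj_trivial, hν]
  have := conf_inv_mul_norm_sq (F u)
  linear_combination (-inner ℝ ν (F u)) * hq - (inner ℝ ν (F u) * q) * this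

/-- The radial component is minus the induced metric; it is the source of the constant `d(d-1)` in
the Gauss equation. -/
lemma inner_sphereLift_pd_pd (hU : IsOpen U) (hF : ContDiffOn ℝ 2 F U) {u : E d} (hu : u ∈ U)
    (i j : Fin d) :
    inner ℝ (sphereLift F u) (pd i (pd j (sphereLift F)) u)
      = -(((conf (F u))⁻¹) ^ 2 * inner ℝ (pd i F u) (pd j F u)) := by
  obtain ⟨q, hq, h⟩ := pd_pd_sphereLift hU hF hu i j
  rw [h, sphereLift, WithLp.prod_inner_apply]
  simp only [inner_add_right, real_inner_smul_left, real_inner_smul_right,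
    RCLike.inner_apply, conj_trivial]
  have := conf_inv_mul_norm_sq (F u)
  linear_combination hq + q * this

end SphereLift

/-! ### The Gauss equation in the round sphere -/

section SphereGauss

variable {d m : ℕ}

lemma linearIndependent_pd {V : Type*} [NormedAddCommGroup V] [NormedSpace ℝ V] {F : E d → V}
    {u : E d} (h : Function.Injective (fderiv ℝ F u)) :
    LinearIndependent ℝ fun i => pd i F u := by
  have hb := (EuclideanSpace.basisFun (Fin d) ℝ).toBasis.linearIndependent
  have := hb.map' (fderiv ℝ F u : E d →ₗ[ℝ] V) (LinearMap.ker_eq_bot.2 h)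
  convert! this using 2 with i
  simp [pd]

lemma posDef_inducedMetric {g : MetricField m} {c : E m → ℝ} (hg : ∀ x, g x = c x • 1)
    (hc : ∀ x, 0 < c x) {F : E d → E m} {u : E d} (h : Function.Injective (fderiv ℝ F u)) :
    (inducedMetric g F u).PosDef := by
  have : inducedMetric g F u = c (F u) • Matrix.gram ℝ fun i => pd i F u := by
    ext i j
    rw [inducedMetric_smul_one hg, Matrix.smul_apply, Matrix.gram_apply, smul_eq_mul]
  rw [this]
  exact (Matrix.posDef_gram_of_linearIndependent (linearIndependent_pd h)).smul (hc _)

lemma inducedMetric_roundMetric (F : E d → E m) (u : E d) (i j : Fin d) :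
    inducedMetric (roundMetric m) F u i j
      = (conf (F u) ^ 2)⁻¹ * inner ℝ (pd i F u) (pd j F u) :=
  inducedMetric_smul_one (c := fun x => (conf x ^ 2)⁻¹) (fun _ => rfl) F u i j

lemma posDef_inducedMetric_roundMetric {F : E d → E m} {u : E d}
    (h : Function.Injective (fderiv ℝ F u)) : (inducedMetric (roundMetric m) F u).PosDef :=
  posDef_inducedMetric (fun _ => rfl) (fun x => by have := conf_pos x; positivity) h

lemma isIsometricImmersionOn_sphereLift {F : E d → E m} {U : Set (E d)} (hU : IsOpen U)
    (hF : ContDiffOn ℝ 2 F U) (hinj : ∀ u ∈ U, Function.Injective (fderiv ℝ F u)) :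
    IsIsometricImmersionOn (inducedMetric (roundMetric m) F) (sphereLift F) U where
  isOpen := hU
  contDiffOn := contDiffOn_sphereLift hF
  metric_eq u hu j k := by
    rw [inner_pd_sphereLift ((hF.contDiffAt (hU.mem_nhds hu)).differentiableAt two_ne_zero),
      inducedMetric_roundMetric, inv_pow]
  isUnit_det u hu := (posDef_inducedMetric_roundMetric (hinj u hu)).det_pos.ne'.isUnit

/-- Pairing with `v`, `a`, `b` is a linear map between spaces of dimension `d + 2`. The dual vectors
`w` give explicit preimages, so it is surjective, hence injective. -/
lemma eq_of_inner_frame_eq {V : Type*} [NormedAddCommGroup V] [InnerProductSpace ℝ V]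
    [FiniteDimensional ℝ V] (hV : Module.finrank ℝ V = d + 2) {v w : Fin d → V} {a b : V}
    (hwv : ∀ i j, inner ℝ (w i) (v j) = if i = j then (1 : ℝ) else 0)
    (hwa : ∀ i, inner ℝ (w i) a = 0) (hwb : ∀ i, inner ℝ (w i) b = 0)
    (hva : ∀ i, inner ℝ a (v i) = 0) (hvb : ∀ i, inner ℝ b (v i) = 0)
    (haa : inner ℝ a a = (1 : ℝ)) (hbb : inner ℝ b b = (1 : ℝ)) (hab : inner ℝ a b = 0)
    {x y : V} (hv : ∀ i, inner ℝ (v i) x = inner ℝ (v i) y) (ha : inner ℝ a x = inner ℝ a y)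
    (hb : inner ℝ b x = inner ℝ b y) : x = y := by
  let T : V →ₗ[ℝ] (Fin d → ℝ) × ℝ × ℝ :=
    (LinearMap.pi fun i => (innerₛₗ ℝ (v i))).prod ((innerₛₗ ℝ a).prod (innerₛₗ ℝ b))
  have hT : ∀ z, T z = (fun i => inner ℝ (v i) z, inner ℝ a z, inner ℝ b z) := fun z => rfl
  have hsurj : Function.Surjective T := by
    rintro ⟨c, s, t⟩
    refine ⟨∑ i, c i • w i + s • a + t • b, ?_⟩
    rw [hT]
    have hvw : ∀ i j, inner ℝ (v i) (w j) = if j = i then (1 : ℝ) else 0 := fun i j => by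
      rw [real_inner_comm, hwv]
    have hba : inner ℝ b a = (0 : ℝ) := by rw [real_inner_comm, hab]
    have hva' : ∀ i, inner ℝ (v i) a = (0 : ℝ) := fun i => by rw [real_inner_comm, hva]
    have hvb' : ∀ i, inner ℝ (v i) b = (0 : ℝ) := fun i => by rw [real_inner_comm, hvb]
    have hwa' : ∀ i, inner ℝ a (w i) = (0 : ℝ) := fun i => by rw [real_inner_comm, hwa]
    have hwb' : ∀ i, inner ℝ b (w i) = (0 : ℝ) := fun i => by rw [real_inner_comm, hwb]
    simp only [inner_add_right, inner_sum, real_inner_smul_right, haa, hbb, hab, hvw, hba, hva',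
      hvb', hwa', hwb']
    simp
  have hinj : Function.Injective T :=
    (LinearMap.injective_iff_surjective_of_finrank_eq_finrank (by simp [hV])).2 hsurj
  refine hinj ?_
  rw [hT, hT, ha, hb]
  simp [hv]

lemma sum_mul_sub_eq_trace {ι : Type*} [Fintype ι] (Q B : Matrix ι ι ℝ)
    (hB : ∀ i j, B i j = B j i) :
    ∑ j, ∑ k, ∑ i, ∑ m, Q j k * Q i m * (B i m * B j k - B j m * B i k)
      = (Q * B).trace ^ 2 - (Q * B * (Q * B)).trace := by
  have h1 : (Q * B).trace = ∑ j, ∑ k, Q j k * B j k := by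
    simp only [Matrix.trace, Matrix.diag, Matrix.mul_apply]
    exact Finset.sum_congr rfl fun j _ => Finset.sum_congr rfl fun k _ => by rw [hB]
  have h2 : (Q * B * (Q * B)).trace
      = ∑ j, ∑ k, ∑ i, ∑ m, Q j k * Q i m * (B j m * B i k) := by
    simp only [Matrix.trace, Matrix.diag, Matrix.mul_apply, Finset.sum_mul_sum]
    have : ∀ k, ∑ i, ∑ j, ∑ m, Q k j * B j i * (Q i m * B m k)
        = ∑ j, ∑ i, ∑ m, Q k j * Q i m * (B k m * B i j) := fun k => by
      rw [Finset.sum_comm]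
      refine Finset.sum_congr rfl fun j _ => Finset.sum_congr rfl fun i _ =>
        Finset.sum_congr rfl fun m _ => ?_
      rw [hB j i, hB m k]
      ring
    exact Finset.sum_congr rfl fun k _ => this k
  rw [h2, h1, sq, Finset.sum_mul]
  simp_rw [mul_sub, Finset.sum_sub_distrib]
  congr 1
  refine Finset.sum_congr rfl fun j _ => ?_
  rw [Finset.sum_mul]
  refine Finset.sum_congr rfl fun k _ => ?_
  rw [Finset.mul_sum]
  refine Finset.sum_congr rfl fun i _ => ?_
  rw [Finset.mul_sum]
  exact Finset.sum_congr rfl fun m _ => by ring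

/-- The Gauss equation for `C²` hypersurfaces of the round sphere. -/
theorem scalarCurvature_eq {F : E d → E (d + 1)} {U : Set (E d)} (hU : IsOpen U)
    (hF : ContDiffOn ℝ 2 F U) (hinj : ∀ u ∈ U, Function.Injective (fderiv ℝ F u))
    {R : E d → ℝ} (hR : IsScalarCurvatureOn (inducedMetric (roundMetric (d + 1)) F) U R)
    {u : E d} (hu : u ∈ U) {ν : E (d + 1)} (hν : IsUnitNormal F ν u) :
    R u = d * ((d : ℝ) - 1)
      + (shapeOperator (roundMetric (d + 1)) F (conf (F u) • ν) u).trace ^ 2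
      - (shapeOperator (roundMetric (d + 1)) F (conf (F u) • ν) u
        * shapeOperator (roundMetric (d + 1)) F (conf (F u) • ν) u).trace := by
  have H := isIsometricImmersionOn_sphereLift hU hF hinj
  set h := inducedMetric (roundMetric (d + 1)) F with hh
  set A := secondForm (roundMetric (d + 1)) F (conf (F u) • ν) u with hA
  have hd : DifferentiableAt ℝ F u := (hF.contDiffAt (hU.mem_nhds hu)).differentiableAt two_ne_zero
  have hν' : ∀ i, inner ℝ ν (pd i F u) = 0 := fun i => hν.2 _
  have hAeq : ∀ i j, inner ℝ (normalLift (F u) ν) (pd i (pd j (sphereLift F)) u) = A i j := by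
    intro i j
    rw [inner_normalLift_pd_pd hU hF hu hν', hA, conf_eq,
      secondForm_conformal one_pos roundMetric_eq hν', inv_pow]
  have hheq : ∀ i j, inner ℝ (sphereLift F u) (pd i (pd j (sphereLift F)) u) = - h u i j := by
    intro i j
    rw [inner_sphereLift_pd_pd hU hF hu, hh, inducedMetric_roundMetric, inv_pow]
  have hna : ∀ i, inner ℝ (normalLift (F u) ν) (pd i (sphereLift F) u) = 0 := fun i =>
    inner_normalLift_pd hd i (hν' i)
  have hsa : ∀ i, inner ℝ (sphereLift F u) (pd i (sphereLift F) u) = 0 := inner_sphereLift_pd hd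
  have hdual : ∀ z, (∀ i, inner ℝ z (pd i (sphereLift F) u) = 0) →
      ∀ i, inner ℝ (dualFrame h (sphereLift F) i u) z = 0 := by
    intro z hz i
    rw [dualFrame, sum_inner]
    exact Finset.sum_eq_zero fun m _ => by
      rw [real_inner_smul_left, real_inner_comm, hz, mul_zero]
  -- The lift has codimension two, with orthonormal normal frame given by the lifted `ν` and the
  -- position vector on the sphere.
  have hN : ∀ i j, normalPart h (sphereLift F) i j u
      = A i j • normalLift (F u) ν + (-h u i j) • sphereLift F u := by
    intro i j
    have hrank : Module.finrank ℝ (WithLp 2 (E (d + 1) × ℝ)) = d + 2 := by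
      rw [(WithLp.linearEquiv 2 ℝ (E (d + 1) × ℝ)).finrank_eq]
      simp
    refine eq_of_inner_frame_eq hrank (v := fun i => pd i (sphereLift F) u)
      (w := fun i => dualFrame h (sphereLift F) i u) (a := normalLift (F u) ν)
      (b := sphereLift F u) (H.inner_dualFrame hu) (hdual _ hna) (hdual _ hsa) hna hsa
      (inner_normalLift_self hν.1) (inner_sphereLift_self u) (inner_normalLift_sphereLift u ν)
      ?_ ?_ ?_
    · intro k
      rw [H.inner_pd_normalPart hu, inner_add_right, real_inner_smul_right, real_inner_smul_right,
        real_inner_comm, hna, real_inner_comm, hsa]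
      simp
    · rw [normalPart, inner_sub_right, inner_sum, hAeq, inner_add_right, real_inner_smul_right,
        real_inner_smul_right, inner_normalLift_self hν.1, inner_normalLift_sphereLift]
      simp only [real_inner_smul_right, hna, mul_zero, Finset.sum_const_zero]
      ring
    · rw [normalPart, inner_sub_right, inner_sum, hheq, inner_add_right, real_inner_smul_right,
        real_inner_smul_right, inner_sphereLift_self, real_inner_comm, inner_normalLift_sphereLift]
      simp only [real_inner_smul_right, hsa, mul_zero, Finset.sum_const_zero]
      ring
  have hNN : ∀ i j k l, inner ℝ (normalPart h (sphereLift F) i j u)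
      (normalPart h (sphereLift F) k l u) = A i j * A k l + h u i j * h u k l := by
    intro i j k l
    rw [hN, hN]
    simp only [inner_add_left, inner_add_right, real_inner_smul_left, real_inner_smul_right,
      inner_normalLift_self hν.1, inner_sphereLift_self, inner_normalLift_sphereLift,
      real_inner_comm (normalLift (F u) ν) (sphereLift F u)]
    ring
  have hAs : ∀ i j, A i j = A j i := fun i j => by rw [← hAeq, ← hAeq, H.pd_comm hu]
  have e1 := sum_mul_sub_eq_trace (h u)⁻¹ A hAs
  -- The same contraction with the metric in place of `A`: the product becomes the identity and
  -- contributes `d² - d`.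
  have e2 := sum_mul_sub_eq_trace (h u)⁻¹ (h u) (H.symm hu)
  rw [Matrix.nonsing_inv_mul _ (H.isUnit_det u hu), mul_one, Matrix.trace_one,
    Fintype.card_fin] at e2
  rw [H.eqOn_gaussScalar hR hu, gaussScalar, shapeOperator, ← hh, ← hA]
  simp_rw [hNN]
  have e3 : ∑ j, ∑ k, ∑ i, ∑ m, (h u)⁻¹ j k * (h u)⁻¹ i m *
      (A i m * A j k + h u i m * h u j k - (A j m * A i k + h u j m * h u i k))
      = ∑ j, ∑ k, ∑ i, ∑ m, (h u)⁻¹ j k * (h u)⁻¹ i m * (A i m * A j k - A j m * A i k)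
        + ∑ j, ∑ k, ∑ i, ∑ m,
          (h u)⁻¹ j k * (h u)⁻¹ i m * (h u i m * h u j k - h u j m * h u i k) := by
    simp_rw [← Finset.sum_add_distrib]
    refine Finset.sum_congr rfl fun j _ => Finset.sum_congr rfl fun k _ =>
      Finset.sum_congr rfl fun i _ => Finset.sum_congr rfl fun m _ => by ring
  rw [e3, e1, e2]
  ring

end SphereGauss

/-! ### The trace inequality and its case of equality -/

section TraceInequality

open Matrix

variable {ι κ : Type*} [Fintype ι] [Fintype κ] {h A : Matrix ι ι ℝ} {P : Matrix ι κ ℝ} {N : ι → ℝ}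

/-- Cyclicity of the trace exhibits the left side as the squared Frobenius norm of `C Z Cᵀ`, which
gives positivity and, for invertible `C`, definiteness. -/
lemma trace_mul_mul_self {K Z C : Matrix κ κ ℝ} (hZ : Zᵀ = Z) (h : K = Cᵀ * C) :
    (K * Z * (K * Z)).trace = ((C * Z * Cᵀ)ᵀ * (C * Z * Cᵀ)).trace := by
  rw [transpose_mul, transpose_mul, transpose_transpose, hZ, h]
  simp only [Matrix.mul_assoc]
  rw [trace_mul_comm]
  simp only [Matrix.mul_assoc]

lemma normal_dotProduct (hs : hᵀ = h) (hN : Pᵀ *ᵥ (h *ᵥ N) = 0) (y : κ → ℝ) :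
    N ⬝ᵥ h *ᵥ (P *ᵥ y) = 0 := by
  have : N ⬝ᵥ h *ᵥ (P *ᵥ y) = (Pᵀ *ᵥ (h *ᵥ N)) ⬝ᵥ y := by
    rw [mulVec_transpose, ← dotProduct_mulVec, dotProduct_mulVec, ← mulVec_transpose, hs]
  rw [this, hN, zero_dotProduct]

/-- There is a unit normal vector to the range of `P` with respect to the inner product `h`. -/
lemma exists_unit_normal [DecidableEq ι] (hh : h.PosDef) (hcard : Fintype.card ι = Fintype.card κ + 1) :
    ∃ N : ι → ℝ, Pᵀ *ᵥ (h *ᵥ N) = 0 ∧ N ⬝ᵥ h *ᵥ N = 1 := by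
  -- The source has one dimension more than the target, so there is a nonzero vector orthogonal to
  -- the range of `P`.
  have hker : LinearMap.ker (toLin' (Pᵀ * h)) ≠ ⊥ :=
    LinearMap.ker_ne_bot_of_finrank_lt (by simp [hcard])
  obtain ⟨x, hx, hx0⟩ := Submodule.exists_mem_ne_zero_of_ne_bot hker
  rw [LinearMap.mem_ker, toLin'_apply, ← mulVec_mulVec] at hx
  have hpos : 0 < x ⬝ᵥ h *ᵥ x := by simpa using hh.dotProduct_mulVec_pos hx0
  refine ⟨(√(x ⬝ᵥ h *ᵥ x))⁻¹ • x, ?_, ?_⟩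
  · rw [mulVec_smul, mulVec_smul, hx, smul_zero]
  · rw [mulVec_smul, smul_dotProduct, dotProduct_smul, smul_smul, smul_eq_mul, ← mul_inv,
      Real.mul_self_sqrt hpos.le, inv_mul_cancel₀ hpos.ne']

lemma exists_decomposition (hP : Function.Injective P.mulVec)
    (hcard : Fintype.card ι = Fintype.card κ + 1) (hs : hᵀ = h)
    (hN : Pᵀ *ᵥ (h *ᵥ N) = 0) (hN1 : N ⬝ᵥ h *ᵥ N = 1) (x : ι → ℝ) :
    ∃ (y : κ → ℝ) (t : ℝ), x = P *ᵥ y + t • N := by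
  let T : (κ → ℝ) × ℝ →ₗ[ℝ] ι → ℝ :=
    P.mulVecLin.coprod (LinearMap.toSpanSingleton ℝ (ι → ℝ) N)
  have hT : ∀ y t, T (y, t) = P *ᵥ y + t • N := fun y t => rfl
  have hinj : Function.Injective T := by
    rw [injective_iff_map_eq_zero]
    rintro ⟨y, t⟩ h0
    rw [hT] at h0
    have h1 : N ⬝ᵥ h *ᵥ (P *ᵥ y + t • N) = 0 := by rw [h0, mulVec_zero, dotProduct_zero]
    rw [mulVec_add, dotProduct_add, normal_dotProduct hs hN, mulVec_smul, dotProduct_smul, hN1]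
      at h1
    have ht : t = 0 := by simpa using h1
    subst ht
    have : y = 0 := hP (by simpa using h0)
    simp [this]
  have hsurj : Function.Surjective T :=
    (LinearMap.injective_iff_surjective_of_finrank_eq_finrank (by simp [hcard])).1 hinj
  obtain ⟨⟨y, t⟩, hyt⟩ := hsurj x
  exact ⟨y, t, by rw [← hyt, hT]⟩

variable [DecidableEq ι] [DecidableEq κ]

open scoped MatrixOrder ComplexOrder in
lemma exists_eq_transpose_mul_self {K : Matrix κ κ ℝ} (hK : K.PosDef) :
    ∃ C : Matrix κ κ ℝ, IsUnit C ∧ K = Cᵀ * C := by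
  obtain ⟨C, hC, h⟩ := CStarAlgebra.isStrictlyPositive_iff_eq_star_mul_self.mp hK.isStrictlyPositive
  exact ⟨C, hC, by rw [h, star_eq_conjTranspose, conjTranspose_eq_transpose_of_trivial]⟩

lemma trace_mul_mul_self_nonneg {K Z : Matrix κ κ ℝ} (hK : K.PosDef) (hZ : Zᵀ = Z) :
    0 ≤ (K * Z * (K * Z)).trace := by
  obtain ⟨C, -, h⟩ := exists_eq_transpose_mul_self hK
  rw [trace_mul_mul_self hZ h, ← conjTranspose_eq_transpose_of_trivial]
  exact (posSemidef_conjTranspose_mul_self _).trace_nonneg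

lemma trace_mul_mul_self_eq_zero {K Z : Matrix κ κ ℝ} (hK : K.PosDef) (hZ : Zᵀ = Z)
    (h0 : (K * Z * (K * Z)).trace = 0) : Z = 0 := by
  obtain ⟨C, hC, h⟩ := exists_eq_transpose_mul_self hK
  rw [trace_mul_mul_self hZ h, ← conjTranspose_eq_transpose_of_trivial,
    trace_conjTranspose_mul_self_eq_zero_iff] at h0
  have hCt : IsUnit Cᵀ := by rwa [isUnit_transpose]
  have h1 : C * Z = 0 := by
    have := hCt.mul_left_injective (a₁ := C * Z) (a₂ := 0)
    exact this (by simpa using h0)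
  exact hC.mul_right_injective (by simpa using h1)

/-- The inverse metric splits along the range of `P` and its unit normal; it is enough to check this
on vectors `P y + t N`. -/
lemma inv_eq_add_vecMulVec (hP : Function.Injective P.mulVec)
    (hcard : Fintype.card ι = Fintype.card κ + 1) (hs : hᵀ = h)
    (hK : IsUnit (Pᵀ * h * P).det)
    (hN : Pᵀ *ᵥ (h *ᵥ N) = 0) (hN1 : N ⬝ᵥ h *ᵥ N = 1) :
    h⁻¹ = P * (Pᵀ * h * P)⁻¹ * Pᵀ + vecMulVec N N := by
  refine inv_eq_left_inv ?_
  refine ext_of_mulVec_single fun i => ?_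
  generalize (Pi.single i (1 : ℝ) : ι → ℝ) = x
  obtain ⟨y, t, rfl⟩ := exists_decomposition hP hcard hs hN hN1 x
  have h1 : Pᵀ *ᵥ (h *ᵥ (P *ᵥ y)) = (Pᵀ * h * P) *ᵥ y := by
    simp [Matrix.mul_assoc]
  rw [one_mulVec, ← mulVec_mulVec, add_mulVec, mulVec_add, mulVec_smul, vecMulVec_mulVec,
    dotProduct_add, dotProduct_smul, normal_dotProduct hs hN, hN1, ← mulVec_mulVec, ← mulVec_mulVec,
    mulVec_add, mulVec_smul, hN, h1, smul_zero, add_zero, mulVec_mulVec _ (Pᵀ * h * P)⁻¹,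
    nonsing_inv_mul _ hK]
  simp

lemma trace_inv_mul (hinv : h⁻¹ = P * (Pᵀ * h * P)⁻¹ * Pᵀ + vecMulVec N N) :
    (h⁻¹ * A).trace = ((Pᵀ * h * P)⁻¹ * (Pᵀ * A * P)).trace + N ⬝ᵥ A *ᵥ N := by
  rw [hinv, Matrix.add_mul, trace_add, vecMulVec_mul, trace_vecMulVec]
  congr 1
  · rw [Matrix.mul_assoc, Matrix.mul_assoc, trace_mul_comm]
    simp only [Matrix.mul_assoc]
  · rw [dotProduct_comm, dotProduct_mulVec]

/-- Block form of `tr S²`: by symmetry of `A` the off-diagonal block occurs twice. -/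
lemma trace_inv_mul_sq (hA : Aᵀ = A)
    (hinv : h⁻¹ = P * (Pᵀ * h * P)⁻¹ * Pᵀ + vecMulVec N N) :
    (h⁻¹ * A * (h⁻¹ * A)).trace
      = ((Pᵀ * h * P)⁻¹ * (Pᵀ * A * P) * ((Pᵀ * h * P)⁻¹ * (Pᵀ * A * P))).trace
        + 2 * ((Pᵀ *ᵥ (A *ᵥ N)) ⬝ᵥ (Pᵀ * h * P)⁻¹ *ᵥ (Pᵀ *ᵥ (A *ᵥ N)))
        + (N ⬝ᵥ A *ᵥ N) ^ 2 := by
  rw [hinv]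
  generalize (Pᵀ * h * P)⁻¹ = L
  have hvec : N ᵥ* A = A *ᵥ N := by rw [← mulVec_transpose, hA]
  have e1 : (P * L * Pᵀ * A * (P * L * Pᵀ * A)).trace
      = (L * (Pᵀ * A * P) * (L * (Pᵀ * A * P))).trace := by
    rw [show P * L * Pᵀ * A * (P * L * Pᵀ * A) = P * (L * Pᵀ * A * (P * L * Pᵀ * A)) by
      simp only [Matrix.mul_assoc], trace_mul_comm]
    simp only [Matrix.mul_assoc]
  have e2 : (P * L * Pᵀ * A * (vecMulVec N N * A)).trace
      = (Pᵀ *ᵥ (A *ᵥ N)) ⬝ᵥ L *ᵥ (Pᵀ *ᵥ (A *ᵥ N)) := by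
    rw [vecMulVec_mul, mul_vecMulVec, trace_vecMulVec, hvec, dotProduct_comm]
    simp only [← mulVec_mulVec]
    rw [dotProduct_mulVec, ← mulVec_transpose]
  have e3 : (vecMulVec N N * A * (P * L * Pᵀ * A)).trace
      = (P * L * Pᵀ * A * (vecMulVec N N * A)).trace := trace_mul_comm _ _
  have e4 : (vecMulVec N N * A * (vecMulVec N N * A)).trace = (N ⬝ᵥ A *ᵥ N) ^ 2 := by
    rw [vecMulVec_mul, vecMulVec_mul_vecMulVec, trace_vecMulVec, dotProduct_smul, hvec,
      dotProduct_comm, smul_eq_mul, sq]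
  simp only [Matrix.add_mul, Matrix.mul_add, trace_add]
  rw [e1, e3, e2, e4]
  ring

/-- The algebraic inequality behind the comparison of the mean curvature of a hypersurface with that
of its level set, with the case of equality. -/
theorem trace_inequality (hh : h.PosDef) (hA : Aᵀ = A) (hP : Function.Injective P.mulVec)
    (hcard : Fintype.card ι = Fintype.card κ + 1) (hκ : 0 < Fintype.card κ)
    {S : Matrix ι ι ℝ} {T : Matrix κ κ ℝ} (hS : S = h⁻¹ * A)
    (hT : T = (Pᵀ * h * P)⁻¹ * (Pᵀ * A * P)) :
    (1 / 2) * (S.trace ^ 2 - (S * S).trace)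
        + (Fintype.card ι : ℝ) / (2 * Fintype.card κ) * T.trace ^ 2 ≤ S.trace * T.trace ∧
    (S.trace * T.trace = (1 / 2) * (S.trace ^ 2 - (S * S).trace)
        + (Fintype.card ι : ℝ) / (2 * Fintype.card κ) * T.trace ^ 2 ↔
      ∃ r : ℝ, T = r • 1 ∧
        Fintype.card κ ≤ Module.finrank ℝ (Module.End.eigenspace (toLin' S) r)) := by
  have hs : hᵀ = h := by
    have := hh.isHermitian.eq
    rwa [conjTranspose_eq_transpose_of_trivial] at this
  have hKpos : (Pᵀ * h * P).PosDef := by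
    have := hh.conjTranspose_mul_mul_same hP
    rwa [conjTranspose_eq_transpose_of_trivial] at this
  have hhu : IsUnit h.det := hh.det_pos.ne'.isUnit
  have hKu : IsUnit (Pᵀ * h * P).det := hKpos.det_pos.ne'.isUnit
  obtain ⟨N, hN, hN1⟩ := exists_unit_normal (P := P) hh hcard
  have hdec := exists_decomposition hP hcard hs hN hN1
  have hinv := inv_eq_add_vecMulVec hP hcard hs hKu hN hN1
  have t1 := trace_inv_mul (A := A) hinv
  have t2 := trace_inv_mul_sq hA hinv
  rw [← hS, ← hT] at t1 t2
  set K := Pᵀ * h * P with hKdef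
  set B := Pᵀ * A * P with hB
  set v := Pᵀ *ᵥ (A *ᵥ N) with hv
  have hKs : Kᵀ = K := by simp [hKdef, hs, Matrix.mul_assoc]
  have hBs : Bᵀ = B := by simp [hB, hA, Matrix.mul_assoc]
  have hκ' : (0 : ℝ) < Fintype.card κ := by exact_mod_cast hκ
  -- The only possible scalar if `T` is a multiple of the identity; `B - r K` represents the
  -- traceless part of `T`.
  set r := T.trace / Fintype.card κ with hr
  have hZs : (B - r • K)ᵀ = B - r • K := by rw [transpose_sub, transpose_smul, hBs, hKs]
  have hKZ : K⁻¹ * (B - r • K) = T - r • 1 := by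
    rw [Matrix.mul_sub, Matrix.mul_smul, nonsing_inv_mul _ hKu, hT]
  have t3 : (K⁻¹ * (B - r • K) * (K⁻¹ * (B - r • K))).trace
      = (T * T).trace - T.trace ^ 2 / Fintype.card κ := by
    rw [hKZ]
    simp only [Matrix.mul_sub, Matrix.sub_mul, Matrix.mul_smul, Matrix.smul_mul, mul_one, one_mul,
      trace_sub, trace_smul, trace_one, smul_eq_mul, hr]
    field_simp
    ring
  have hci : (Fintype.card ι : ℝ) = Fintype.card κ + 1 := by exact_mod_cast hcard
  -- The deficit is half the squared norm of the traceless part of `T` plus the squared norm of the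
  -- mixed term `v`; the corner entry `N ⬝ᵥ A *ᵥ N` cancels.
  have hdiff : S.trace * T.trace - ((1 / 2) * (S.trace ^ 2 - (S * S).trace)
        + (Fintype.card ι : ℝ) / (2 * Fintype.card κ) * T.trace ^ 2)
      = (1 / 2) * (K⁻¹ * (B - r • K) * (K⁻¹ * (B - r • K))).trace + v ⬝ᵥ K⁻¹ *ᵥ v := by
    rw [t3, t1, t2, hci]
    field_simp
    ring
  have n1 := trace_mul_mul_self_nonneg hKpos.inv hZs
  have n2 : 0 ≤ v ⬝ᵥ K⁻¹ *ᵥ v := by simpa using hKpos.inv.posSemidef.dotProduct_mulVec_nonneg v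
  refine ⟨by linarith, ?_⟩
  have hrange : Module.finrank ℝ (LinearMap.range (toLin' P)) = Fintype.card κ := by
    rw [LinearMap.finrank_range_of_inj hP, Module.finrank_fintype_fun_eq_card]
  have hNA : ∀ y, N ⬝ᵥ A *ᵥ (P *ᵥ y) = v ⬝ᵥ y := by
    intro y
    rw [hv, mulVec_transpose, ← dotProduct_mulVec, dotProduct_mulVec, ← mulVec_transpose, hA]
  have hBy : ∀ y, Pᵀ *ᵥ (A *ᵥ (P *ᵥ y)) = B *ᵥ y := fun y => by simp [hB, Matrix.mul_assoc]
  have hKy : ∀ y, Pᵀ *ᵥ (h *ᵥ (P *ᵥ y)) = K *ᵥ y := fun y => by simp [hKdef, Matrix.mul_assoc]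
  constructor
  · intro heq
    have z1 : (K⁻¹ * (B - r • K) * (K⁻¹ * (B - r • K))).trace = 0 := by linarith
    have z2 : v ⬝ᵥ K⁻¹ *ᵥ v = 0 := by linarith
    have hZ := trace_mul_mul_self_eq_zero hKpos.inv hZs z1
    have hv0 : v = 0 := by
      by_contra hne
      have := hKpos.inv.dotProduct_mulVec_pos hne
      simp only [star_trivial] at this
      linarith
    have hTr : T = r • 1 := by
      rw [hZ, Matrix.mul_zero] at hKZ
      exact (sub_eq_zero.1 hKZ.symm)
    refine ⟨r, hTr, ?_⟩
    rw [← hrange]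
    refine Submodule.finrank_mono ?_
    rintro _ ⟨y, rfl⟩
    rw [Module.End.mem_eigenspace_iff, toLin'_apply, toLin'_apply]
    -- This vector annihilates the range of `P` because `B = r K`, and `N` because `v = 0`; these
    -- span, so it annihilates itself.
    have hw : A *ᵥ (P *ᵥ y) - r • h *ᵥ (P *ᵥ y) = 0 := by
      rw [← dotProduct_self_eq_zero]
      obtain ⟨y', t, hyt⟩ := hdec (A *ᵥ (P *ᵥ y) - r • h *ᵥ (P *ᵥ y))
      nth_rw 1 [hyt]
      have q1 : (P *ᵥ y') ⬝ᵥ (A *ᵥ (P *ᵥ y) - r • h *ᵥ (P *ᵥ y)) = 0 := by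
        rw [dotProduct_comm, dotProduct_mulVec, ← mulVec_transpose, mulVec_sub, mulVec_smul, hBy,
          hKy, sub_eq_zero.1 hZ, smul_mulVec, sub_self, zero_dotProduct]
      rw [add_dotProduct, q1, smul_dotProduct, dotProduct_sub, hNA, hv0, dotProduct_smul,
        normal_dotProduct hs hN]
      simp
    rw [hS, ← mulVec_mulVec, sub_eq_zero.1 hw, mulVec_smul, mulVec_mulVec _ h⁻¹,
      nonsing_inv_mul _ hhu, one_mulVec]
  · rintro ⟨r', hTr, hdim⟩
    have hrr : r' = r := by
      rw [hr, hTr, trace_smul, trace_one, smul_eq_mul]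
      field_simp
    rw [hrr] at hTr hdim
    have hZ : K⁻¹ * (B - r • K) = 0 := by rw [hKZ, hTr, sub_self]
    have hBK : B = r • K := by
      have : K * (K⁻¹ * (B - r • K)) = 0 := by rw [hZ, Matrix.mul_zero]
      rw [← Matrix.mul_assoc, mul_nonsing_inv _ hKu, one_mul] at this
      exact sub_eq_zero.1 this
    have hAx : ∀ x ∈ Module.End.eigenspace (toLin' S) r, A *ᵥ x = r • h *ᵥ x := by
      intro x hx
      rw [Module.End.mem_eigenspace_iff, toLin'_apply, hS] at hx
      have : h *ᵥ ((h⁻¹ * A) *ᵥ x) = A *ᵥ x := by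
        rw [mulVec_mulVec, ← Matrix.mul_assoc, mul_nonsing_inv _ hhu, one_mul]
      rw [← this, hx, mulVec_smul]
    have hv0 : v = 0 := by
      by_contra hne
      have hle : Module.End.eigenspace (toLin' S) r ≤ LinearMap.range (toLin' P) := by
        intro x hx
        have hAx' := hAx x hx
        obtain ⟨y, t, rfl⟩ := hdec x
        -- The tangential part of the eigenvector equation reads `B y + t v = r K y`, and `B = r K`
        -- leaves `t v = 0`.
        have := congrArg (fun z => Pᵀ *ᵥ z) hAx'
        simp only [mulVec_add, mulVec_smul, hBy, hKy, hN, ← hv] at this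
        rw [hBK, smul_mulVec, smul_zero, add_zero] at this
        have htv : t • v = 0 := by simpa using this
        have ht : t = 0 := (smul_eq_zero.1 htv).resolve_right hne
        exact ⟨y, by simp [ht]⟩
      -- If `v ≠ 0`, the eigenspace would be exactly the range of `P`. Then `P v` is an eigenvector,
      -- and pairing its equation with `N` gives `v ⬝ᵥ v = 0`.
      have hEq := Submodule.eq_of_le_of_finrank_le hle (by rw [hrange]; exact hdim)
      refine hne ?_
      rw [← dotProduct_self_eq_zero, ← hNA, hAx _ (hEq ▸ ⟨v, rfl⟩), dotProduct_smul,
        normal_dotProduct hs hN, smul_zero]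
    have z1 : (K⁻¹ * (B - r • K) * (K⁻¹ * (B - r • K))).trace = 0 := by rw [hZ]; simp
    have z2 : v ⬝ᵥ K⁻¹ *ᵥ v = 0 := by rw [hv0]; simp
    linarith

end TraceInequality

/-! ### Horizontal hyperplanes and their induced metric -/

section Level

variable {d k n : ℕ}

lemma inner_eq_inner_horizontal_add (x y : E (n + 1)) :
    inner ℝ x y = inner ℝ (horizontal x) (horizontal y) + x (Fin.last n) * y (Fin.last n) := by
  rw [inner_eq_sum, inner_eq_sum, Fin.sum_univ_castSucc]
  rfl

lemma inner_slice_zero (x : E (n + 1)) (η : E n) :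
    inner ℝ x (slice 0 η) = inner ℝ (horizontal x) η := by
  rw [inner_eq_inner_horizontal_add]
  have h1 : horizontal (slice 0 η) = η := by ext i; simp [horizontal, slice]
  have h2 : slice 0 η (Fin.last n) = 0 := by simp [slice]
  rw [h1, h2, mul_zero, add_zero]

lemma inner_vertical (x : E (n + 1)) : inner ℝ x (vertical n) = x (Fin.last n) := by
  simp [vertical, EuclideanSpace.inner_single_right]

lemma pd_clm_comp {V W : Type*} [NormedAddCommGroup V] [NormedSpace ℝ V] [NormedAddCommGroup W]
    [NormedSpace ℝ W] (L : V →L[ℝ] W) {f : E d → V} {u : E d} (hf : DifferentiableAt ℝ f u)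
    (i : Fin d) : pd i (fun y => L (f y)) u = L (pd i f u) := by
  rw [pd, show (fun y => L (f y)) = L ∘ f from rfl, (L.hasFDerivAt.comp u hf.hasFDerivAt).fderiv]
  rfl

/-- The projection `ℝⁿ × ℝ → ℝⁿ` as a continuous linear map. -/
def horizontalCLM (n : ℕ) : E (n + 1) →L[ℝ] E n :=
  LinearMap.toContinuousLinearMap
    { toFun := horizontal
      map_add' := fun _ _ => rfl
      map_smul' := fun _ _ => rfl }

lemma pd_horizontal {f : E d → E (n + 1)} {u : E d} (hf : DifferentiableAt ℝ f u) (i : Fin d) :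
    pd i (fun y => horizontal (f y)) u = horizontal (pd i f u) :=
  pd_clm_comp (horizontalCLM n) hf i

lemma fderiv_eq_sum_pd {V : Type*} [NormedAddCommGroup V] [NormedSpace ℝ V] (f : E d → V)
    (u v : E d) : fderiv ℝ f u v = ∑ i, v i • pd i f u := by
  conv_lhs => rw [← (EuclideanSpace.basisFun (Fin d) ℝ).sum_repr v]
  simp [pd]

lemma pd_comp {m : ℕ} {V : Type*} [NormedAddCommGroup V] [NormedSpace ℝ V] {F : E m → V}
    {γ : E d → E m} {b : E d} (hF : DifferentiableAt ℝ F (γ b)) (hγ : DifferentiableAt ℝ γ b)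
    (i : Fin d) : pd i (fun y => F (γ y)) b = ∑ l, pd i γ b l • pd l F (γ b) := by
  rw [pd, show (fun y => F (γ y)) = F ∘ γ from rfl,
    (hF.hasFDerivAt.comp b hγ.hasFDerivAt).fderiv, ContinuousLinearMap.comp_apply,
    fderiv_eq_sum_pd F]
  rfl

lemma norm_slice_sq (ε : ℝ) (y : E n) : ‖slice ε y‖ ^ 2 = ‖y‖ ^ 2 + ε ^ 2 := by
  rw [EuclideanSpace.real_norm_sq_eq, EuclideanSpace.real_norm_sq_eq, Fin.sum_univ_castSucc]
  simp [slice]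

lemma conf_slice (ε : ℝ) (y : E n) : conf (slice ε y) = ((1 + ε ^ 2) + ‖y‖ ^ 2) / 2 := by
  rw [conf_eq, norm_slice_sq]
  ring

lemma slice_horizontal {x : E (n + 1)} {ε : ℝ} (hx : x (Fin.last n) = ε) :
    slice ε (horizontal x) = x := by
  ext i
  refine Fin.lastCases ?_ (fun i => ?_) i <;> simp [slice, horizontal, hx]

lemma hasFDerivAt_slice (ε : ℝ) (y : E n) :
    ∃ L : E n →L[ℝ] E (n + 1), HasFDerivAt (slice ε) L y ∧ ∀ v, L v = slice 0 v := by
  let L : E n →L[ℝ] E (n + 1) := LinearMap.toContinuousLinearMap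
    { toFun := slice 0
      map_add' := fun x y => by
        ext i
        refine Fin.lastCases ?_ (fun i => ?_) i <;> simp [slice]
      map_smul' := fun c x => by
        ext i
        refine Fin.lastCases ?_ (fun i => ?_) i <;> simp [slice] }
  have hL : slice ε = fun y : E n => L y + slice ε 0 := by
    funext y
    ext i
    refine Fin.lastCases ?_ (fun i => ?_) i <;> simp [slice, L]
  refine ⟨L, ?_, fun v => rfl⟩
  rw [hL]
  exact L.hasFDerivAt.add_const _

lemma inducedMetric_slice (ε : ℝ) (y : E n) :
    inducedMetric (roundMetric (n + 1)) (slice ε) y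
      = ((((1 + ε ^ 2) + ‖y‖ ^ 2) / 2) ^ 2)⁻¹ • (1 : Matrix (Fin n) (Fin n) ℝ) := by
  obtain ⟨L, hL, hLv⟩ := hasFDerivAt_slice ε y
  have hpd : ∀ i, pd i (slice ε) y = slice 0 (EuclideanSpace.single i 1) := fun i => by
    rw [pd, hL.fderiv, hLv]
  ext i j
  rw [inducedMetric_roundMetric, hpd, hpd, inner_slice_zero, conf_slice, Matrix.smul_apply,
    smul_eq_mul]
  congr 1
  have h1 : horizontal (slice 0 (EuclideanSpace.single i (1 : ℝ))) = EuclideanSpace.single i 1 := by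
    ext; simp [horizontal, slice]
  rw [h1, EuclideanSpace.inner_single_right, Matrix.one_apply]
  simp [eq_comm]

/-- The orthogonal complement of `k` independent vectors in dimension `k + 1` is a line, spanned by
`η`. -/
lemma eq_inner_smul_of_orthogonal {v : Fin k → E n} (hv : LinearIndependent ℝ v) (hn : n = k + 1)
    {η z : E n} (hη : ‖η‖ = 1) (hηv : ∀ i, inner ℝ η (v i) = 0) (hzv : ∀ i, inner ℝ z (v i) = 0) :
    z = inner ℝ z η • η := by
  have hη0 : η ≠ 0 := by rintro rfl; simp at hη
  have hrank : Module.finrank ℝ (Submodule.span ℝ (Set.range v))ᗮ = 1 := by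
    have h1 := Submodule.finrank_add_finrank_orthogonal (Submodule.span ℝ (Set.range v))
    rw [finrank_span_eq_card hv] at h1
    simp only [Fintype.card_fin, finrank_euclideanSpace] at h1
    omega
  have hmem : ∀ z : E n, (∀ i, inner ℝ z (v i) = 0) → z ∈ (Submodule.span ℝ (Set.range v))ᗮ := by
    intro z hz
    rw [Submodule.mem_orthogonal']
    intro w hw
    induction hw using Submodule.span_induction with
    | mem x hx => obtain ⟨i, rfl⟩ := hx; exact hz i
    | zero => exact inner_zero_right _
    | add x y _ _ hx hy => rw [inner_add_right, hx, hy, add_zero]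
    | smul a x _ hx => rw [real_inner_smul_right, hx, mul_zero]
  obtain ⟨c, hc⟩ := (finrank_eq_one_iff_of_nonzero'
    (⟨η, hmem η hηv⟩ : (Submodule.span ℝ (Set.range v))ᗮ)
    (by simpa [Subtype.ext_iff] using hη0)).1 hrank ⟨z, hmem z hzv⟩
  have hc' : c • η = z := congrArg Subtype.val hc
  rw [← hc', real_inner_smul_left, real_inner_self_eq_norm_sq, hη]
  simp

end Level

/-! ### Comparison of the two shape operators in local coordinates -/

section Comparison

open Matrix

variable {k n : ℕ}

lemma secondForm_round {d m : ℕ} {F : E d → E m} {ν : E m} {u : E d}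
    (hν : ∀ i, inner ℝ ν (pd i F u) = 0) (i j : Fin d) :
    secondForm (roundMetric m) F (conf (F u) • ν) u i j
      = (conf (F u))⁻¹ * inner ℝ ν (pd i (pd j F) u)
        + (conf (F u) ^ 2)⁻¹ * inner ℝ (pd i F u) (pd j F u) * inner ℝ ν (F u) := by
  rw [conf_eq, secondForm_conformal one_pos roundMetric_eq hν]

lemma pd_last_conf (x : E (n + 1)) : pd (Fin.last n) conf x = x (Fin.last n) := by
  rw [← pd_quadratic 1]
  exact congrArg (fun f => pd (Fin.last n) f x) (funext conf_eq)

/-- Second derivatives of a composition, paired with a vector normal to the outer map. -/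
lemma inner_pd_pd_comp {V : Type*} [NormedAddCommGroup V] [InnerProductSpace ℝ V] {F : E n → V}
    {U : Set (E n)} (hU : IsOpen U) (hF : ContDiffOn ℝ 2 F U) {γ : E k → E n} {b : E k}
    (hγ : ContDiffAt ℝ 2 γ b) (hb : γ b ∈ U) {ν : V}
    (hν : ∀ l, inner ℝ ν (pd l F (γ b)) = 0) (i j : Fin k) :
    inner ℝ ν (pd i (pd j fun y => F (γ y)) b)
      = ∑ l, ∑ q, pd i γ b q * pd j γ b l * inner ℝ ν (pd q (pd l F) (γ b)) := by
  obtain ⟨O, hOb, hO⟩ := hγ.contDiffOn le_rfl (by simp)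
  obtain ⟨O', hO'O, hO'open, hbO'⟩ := mem_nhds_iff.1 hOb
  have hγO : ContDiffOn ℝ 2 γ O' := hO.mono hO'O
  have hev : ∀ᶠ y in 𝓝 b, y ∈ O' ∧ γ y ∈ U :=
    (hO'open.eventually_mem hbO').and (hγ.continuousAt.eventually_mem (hU.mem_nhds hb))
  have hFd : ∀ x ∈ U, DifferentiableAt ℝ F x := fun x hx =>
    (hF.contDiffAt (hU.mem_nhds hx)).differentiableAt two_ne_zero
  have hγd : ∀ x ∈ O', DifferentiableAt ℝ γ x := fun x hx =>
    (hγO.contDiffAt (hO'open.mem_nhds hx)).differentiableAt two_ne_zero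
  have hpdF : ∀ l, DifferentiableAt ℝ (pd l F) (γ b) := fun l =>
    ((contDiffOn_pd (m := 1) hU hF (by norm_num) l).contDiffAt
      (hU.mem_nhds hb)).differentiableAt one_ne_zero
  have hpdγ : DifferentiableAt ℝ (pd j γ) b :=
    ((contDiffOn_pd (m := 1) hO'open hγO (by norm_num) j).contDiffAt
      (hO'open.mem_nhds hbO')).differentiableAt one_ne_zero
  have hpdγl : ∀ l, DifferentiableAt ℝ (fun y => pd j γ y l) b := fun l =>
    (EuclideanSpace.proj (𝕜 := ℝ) l).differentiableAt.comp b hpdγ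
  have hcomp : ∀ l, DifferentiableAt ℝ (fun y => pd l F (γ y)) b := fun l =>
    (hpdF l).comp b (hγd b hbO')
  have hloc : pd j (fun y => F (γ y)) =ᶠ[𝓝 b] fun y => ∑ l, pd j γ y l • pd l F (γ y) := by
    filter_upwards [hev] with y hy using pd_comp (hFd _ hy.2) (hγd y hy.1) j
  rw [pd_congr hloc, pd_sum _ (fun l _ => (hpdγl l).fun_smul (hcomp l)), inner_sum]
  refine Finset.sum_congr rfl fun l _ => ?_
  -- Second derivatives of `γ` multiply `∂ₗF`, which is orthogonal to `ν`; only second derivatives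
  -- of `F` remain.
  rw [pd_smul (hpdγl l) (hcomp l), inner_add_right, real_inner_smul_right, hν,
    real_inner_smul_right, pd_comp (hpdF l) (hγd b hbO'), inner_sum, mul_zero, zero_add,
    Finset.mul_sum]
  refine Finset.sum_congr rfl fun q _ => ?_
  rw [real_inner_smul_right]
  ring

/-- The comparison of the mean curvatures in local coordinates: `F` parametrizes the hypersurface
and `γ` parametrizes the level set in the coordinates of `F`. -/
theorem meanCurvature_comparison (hn : n = k + 1) (hk : 0 < k) {F : E n → E (n + 1)}
    {U : Set (E n)} (hU : IsOpen U) (hF : ContDiffOn ℝ 2 F U)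
    (hinj : ∀ u ∈ U, Function.Injective (fderiv ℝ F u)) {R : E n → ℝ}
    (hR : IsScalarCurvatureOn (inducedMetric (roundMetric (n + 1)) F) U R)
    {G : E k → E (n + 1)} {γ : E k → E n} {b : E k} (hγ : ContDiffAt ℝ 2 γ b)
    (hγinj : Function.Injective (fderiv ℝ γ b)) (hb : γ b ∈ U)
    (hG : G =ᶠ[𝓝 b] fun y => F (γ y)) {ε : ℝ} (hGε : ∀ᶠ y in 𝓝 b, G y (Fin.last n) = ε)
    (hreg : ∃ l, pd l F (γ b) (Fin.last n) ≠ 0)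
    {ν : E (n + 1)} (hν : IsUnitNormal F ν (γ b))
    {η : E n} (hη : IsUnitNormal (horizontal ∘ G) η b)
    {S : Matrix (Fin n) (Fin n) ℝ}
    (hS : S = shapeOperator (roundMetric (n + 1)) F (conf (G b) • ν) (γ b))
    {L : Matrix (Fin k) (Fin k) ℝ}
    (hL : L = shapeOperator (inducedMetric (roundMetric (n + 1)) (slice ε)) (horizontal ∘ G)
      (conf (G b) • η) b)
    {β : ℝ} (hβ : β = inner ℝ ν (slice 0 η) * L.trace
      + (k : ℝ) * inner ℝ ν (vertical n) * G b (Fin.last n)) :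
    (1 / 2) * (R (γ b) - n * ((n : ℝ) - 1)) + n / (2 * (k : ℝ)) * β ^ 2 ≤ S.trace * β ∧
    (S.trace * β = (1 / 2) * (R (γ b) - n * ((n : ℝ) - 1)) + n / (2 * (k : ℝ)) * β ^ 2 ↔
      ∃ κ : ℝ, L = κ • 1 ∧ k ≤ Module.finrank ℝ (Module.End.eigenspace (toLin' S)
        (inner ℝ ν (slice 0 η) * κ
          + inner ℝ ν (vertical n) * pd (Fin.last n) conf (G b)))) := by
  have hGb : G b = F (γ b) := hG.eq_of_nhds
  have hGεb : G b (Fin.last n) = ε := hGε.self_of_nhds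
  have hFd : DifferentiableAt ℝ F (γ b) :=
    (hF.contDiffAt (hU.mem_nhds hb)).differentiableAt two_ne_zero
  have hγd : DifferentiableAt ℝ γ b := hγ.differentiableAt two_ne_zero
  have hG2 : ContDiffAt ℝ 2 G b :=
    ((hF.contDiffAt (hU.mem_nhds hb)).comp b hγ).congr_of_eventuallyEq hG
  have hGd : ∀ᶠ y in 𝓝 b, DifferentiableAt ℝ G y := by
    filter_upwards [hG2.eventually (by simp)] with y hy using hy.differentiableAt two_ne_zero
  have hpdGd : ∀ j, DifferentiableAt ℝ (pd j G) b := fun j =>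
    (((hG2.fderiv_right (m := 1) (by norm_num)).clm_apply contDiffAt_const)).differentiableAt
      one_ne_zero
  have hν' : ∀ l, inner ℝ ν (pd l F (γ b)) = 0 := fun l => hν.2 _
  have hη' : ∀ i, inner ℝ η (pd i (horizontal ∘ G) b) = 0 := fun i => hη.2 _
  have hGi : ∀ i, pd i G b = ∑ l, pd i γ b l • pd l F (γ b) := fun i => by
    rw [pd_congr hG, pd_comp hFd hγd]
  have hci : ∀ i, pd i (horizontal ∘ G) b = horizontal (pd i G b) := fun i =>
    pd_horizontal hGd.self_of_nhds i
  have hcij : ∀ i j, pd i (pd j (horizontal ∘ G)) b = horizontal (pd i (pd j G) b) := by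
    intro i j
    have : pd j (horizontal ∘ G) =ᶠ[𝓝 b] fun y => horizontal (pd j G y) := by
      filter_upwards [hGd] with y hy using pd_horizontal hy j
    rw [pd_congr this, pd_horizontal (hpdGd j)]
  have hlast : ∀ᶠ y in 𝓝 b, ∀ j, pd j G y (Fin.last n) = 0 := by
    filter_upwards [hGε.eventually_nhds, hGd] with y hy hyd j
    have h1 : (fun z => G z (Fin.last n)) =ᶠ[𝓝 y] fun _ => ε := hy
    rw [← pd_apply hyd, pd_congr h1, pd, fderiv_const_apply]
    rfl
  have hlasti : ∀ j, pd j G b (Fin.last n) = 0 := hlast.self_of_nhds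
  have hlastij : ∀ i j, pd i (pd j G) b (Fin.last n) = 0 := by
    intro i j
    have h1 : (fun z => pd j G z (Fin.last n)) =ᶠ[𝓝 b] fun _ => (0 : ℝ) := by
      filter_upwards [hlast] with y hy using hy j
    rw [← pd_apply (hpdGd j), pd_congr h1, pd, fderiv_const_apply]
    rfl
  have hνGi : ∀ i, inner ℝ ν (pd i G b) = 0 := fun i => by
    rw [hGi, inner_sum]
    exact Finset.sum_eq_zero fun l _ => by rw [real_inner_smul_right, hν', mul_zero]
  -- the matrix of the differential of `γ`
  set P : Matrix (Fin n) (Fin k) ℝ := Matrix.of fun l i => pd i γ b l with hPdef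
  have hP : Function.Injective P.mulVec := by
    have : P.mulVec = (WithLp.ofLp) ∘ fderiv ℝ γ b ∘ (WithLp.toLp 2) := by
      funext v
      ext l
      simp only [Function.comp_apply]
      rw [fderiv_eq_sum_pd]
      simp [hPdef, Matrix.mulVec, dotProduct, mul_comm]
    rw [this]
    exact (WithLp.ofLp_injective 2).comp (hγinj.comp (WithLp.toLp_injective 2))
  have hGli : LinearIndependent ℝ fun i => pd i (horizontal ∘ G) b := by
    refine linearIndependent_pd ?_
    have hGinj : Function.Injective (fderiv ℝ G b) := by
      rw [hG.fderiv_eq, show (fun y => F (γ y)) = F ∘ γ from rfl,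
        (hFd.hasFDerivAt.comp b hγd.hasFDerivAt).fderiv]
      exact (hinj _ hb).comp hγinj
    rw [injective_iff_map_eq_zero]
    intro v hv
    refine (injective_iff_map_eq_zero _).1 hGinj v ?_
    have h1 : horizontal (fderiv ℝ G b v) = 0 := by
      have h0 := ((horizontalCLM n).hasFDerivAt.comp b hGd.self_of_nhds.hasFDerivAt).fderiv
      rw [← hv, show horizontal ∘ G = horizontalCLM n ∘ G from rfl, h0]
      rfl
    have h2 : fderiv ℝ G b v (Fin.last n) = 0 := by
      rw [fderiv_eq_sum_pd]
      simp [hlasti]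
    ext i
    refine Fin.lastCases h2 (fun i => ?_) i
    exact congrArg (fun z : E n => z i) h1
  -- Tangent vectors of the level set are horizontal, so the horizontal part of `ν` is still normal
  -- to it and lies on the line of `η`.
  have hhor : horizontal ν = inner ℝ (horizontal ν) η • η := by
    refine eq_inner_smul_of_orthogonal hGli hn hη.1 hη' fun i => ?_
    have := hνGi i
    rwa [inner_eq_inner_horizontal_add, hlasti, mul_zero, add_zero, ← hci] at this
  set α := inner ℝ (horizontal ν) η with hα
  set c := ν (Fin.last n) * ε with hc
  -- If `α = 0`, then `ν` is vertical, every tangent vector of the hypersurface is horizontal, and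
  -- the height has a critical point.
  have hα0 : α ≠ 0 := by
    intro h0
    rw [h0, zero_smul] at hhor
    have h1 : ν (Fin.last n) ≠ 0 := by
      intro h1
      have : ν = 0 := by
        ext i
        refine Fin.lastCases h1 (fun i => ?_) i
        exact congrArg (fun z : E n => z i) hhor
      have h2 := hν.1
      rw [this, norm_zero] at h2
      exact zero_ne_one h2
    obtain ⟨l, hl⟩ := hreg
    have := hν' l
    rw [inner_eq_inner_horizontal_add, hhor, inner_zero_left, zero_add] at this
    exact (mul_ne_zero h1 hl) this
  -- the two second fundamental forms
  set h := inducedMetric (roundMetric (n + 1)) F (γ b) with hh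
  set A := secondForm (roundMetric (n + 1)) F (conf (G b) • ν) (γ b) with hA
  set hσ := inducedMetric (inducedMetric (roundMetric (n + 1)) (slice ε)) (horizontal ∘ G) b
    with hhσ
  set Aσ := secondForm (inducedMetric (roundMetric (n + 1)) (slice ε)) (horizontal ∘ G)
    (conf (G b) • η) b with hAσ
  -- The factor `φ` at height `ε`, in the form with `a = 1 + ε²`.
  have hconf : conf (G b) = ((1 + ε ^ 2) + ‖(horizontal ∘ G) b‖ ^ 2) / 2 := by
    rw [Function.comp_apply, ← conf_slice, slice_horizontal hGεb]
  have hAij : ∀ i j, A i j = (conf (G b))⁻¹ * inner ℝ ν (pd i (pd j F) (γ b))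
      + (conf (G b) ^ 2)⁻¹ * inner ℝ (pd i F (γ b)) (pd j F (γ b)) * inner ℝ ν (G b) := by
    intro i j
    rw [hA, hGb, secondForm_round hν']
  have hhij : ∀ i j, h i j = (conf (G b) ^ 2)⁻¹ * inner ℝ (pd i F (γ b)) (pd j F (γ b)) := by
    intro i j
    rw [hh, inducedMetric_roundMetric, hGb]
  have hcc : ∀ i j, inner ℝ (pd i (horizontal ∘ G) b) (pd j (horizontal ∘ G) b)
      = inner ℝ (pd i G b) (pd j G b) := by
    intro i j
    rw [hci, hci, inner_eq_inner_horizontal_add (pd i G b), hlasti]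
    ring
  have hhσij : ∀ i j, hσ i j = (conf (G b) ^ 2)⁻¹ * inner ℝ (pd i G b) (pd j G b) := by
    intro i j
    rw [hhσ, inducedMetric_smul_one (inducedMetric_slice ε), ← hconf, hcc]
  have hAσij : ∀ i j, Aσ i j = (conf (G b))⁻¹ * inner ℝ η (horizontal (pd i (pd j G) b))
      + (conf (G b) ^ 2)⁻¹ * inner ℝ (pd i G b) (pd j G b) * inner ℝ η (horizontal (G b)) := by
    intro i j
    rw [hAσ, hconf, secondForm_conformal (by positivity) (inducedMetric_slice ε) hη', hcij, hcc]
    rfl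
  have hPhP : Pᵀ * h * P = hσ := by
    ext i j
    rw [hhσij, hGi, hGi, Matrix.mul_apply]
    simp_rw [Matrix.mul_apply, Finset.sum_mul, Matrix.transpose_apply, hPdef, Matrix.of_apply, hhij]
    rw [inner_sum, Finset.mul_sum]
    refine Finset.sum_congr rfl fun l _ => ?_
    rw [sum_inner, Finset.mul_sum]
    refine Finset.sum_congr rfl fun q _ => ?_
    rw [real_inner_smul_left, real_inner_smul_right]
    ring
  have hνG : inner ℝ ν (G b) = α * inner ℝ η (horizontal (G b)) + c := by
    rw [inner_eq_inner_horizontal_add, hhor, real_inner_smul_left, hGεb]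
  -- Second derivatives of `G` are horizontal, so `ν` acts on them as `α η`. The position vector has
  -- height `ε`, and its vertical part accounts for the term `c hσ`.
  have hPAP : Pᵀ * A * P = α • Aσ + c • hσ := by
    rw [← hPhP]
    ext i j
    have e1 : (Pᵀ * A * P) i j = (conf (G b))⁻¹ * inner ℝ ν (pd i (pd j G) b)
        + (Pᵀ * h * P) i j * inner ℝ ν (G b) := by
      have hGij : pd i (pd j G) b = pd i (pd j fun y => F (γ y)) b := by
        refine pd_congr ?_ i
        filter_upwards [hG.eventually_nhds] with y hy using pd_congr hy j
      rw [hGij, inner_pd_pd_comp hU hF hγ hb hν', Matrix.mul_apply, Matrix.mul_apply]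
      simp_rw [Matrix.mul_apply, Finset.sum_mul, Matrix.transpose_apply, hPdef, Matrix.of_apply,
        hAij, hhij]
      rw [Finset.mul_sum, ← Finset.sum_add_distrib]
      refine Finset.sum_congr rfl fun l _ => ?_
      rw [Finset.mul_sum, ← Finset.sum_add_distrib]
      exact Finset.sum_congr rfl fun q _ => by ring
    have e2 : inner ℝ ν (pd i (pd j G) b) = α * inner ℝ η (horizontal (pd i (pd j G) b)) := by
      rw [inner_eq_inner_horizontal_add, hlastij, mul_zero, add_zero, hhor, real_inner_smul_left]
    rw [e1, e2, hνG, Matrix.add_apply, Matrix.smul_apply, Matrix.smul_apply, hPhP, hAσij, hhσij,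
      smul_eq_mul, smul_eq_mul]
    ring
  have hpos : h.PosDef := posDef_inducedMetric_roundMetric (hinj _ hb)
  have hAs : Aᵀ = A := by
    ext i j
    rw [Matrix.transpose_apply, hAij, hAij, pd_pd_comm (hF.contDiffAt (hU.mem_nhds hb)),
      real_inner_comm (pd i F (γ b))]
  have hσu : IsUnit hσ.det := by
    have := hpos.conjTranspose_mul_mul_same hP
    rw [conjTranspose_eq_transpose_of_trivial, hPhP] at this
    exact this.det_pos.ne'.isUnit
  set T := (Pᵀ * h * P)⁻¹ * (Pᵀ * A * P) with hT
  have hTL : T = α • L + c • 1 := by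
    rw [hT, hPAP, hPhP, hL, shapeOperator, ← hhσ, ← hAσ, Matrix.mul_add, Matrix.mul_smul,
      Matrix.mul_smul, nonsing_inv_mul _ hσu]
  have hTβ : T.trace = β := by
    rw [hβ, hTL, trace_add, trace_smul, trace_smul, trace_one, Fintype.card_fin, inner_slice_zero,
      inner_vertical, hGεb, smul_eq_mul, smul_eq_mul, ← hα, hc]
    ring
  have hSdef : S = h⁻¹ * A := by rw [hS, shapeOperator]
  obtain ⟨h1, h2⟩ := trace_inequality hpos hAs hP (by simp [hn]) (by simpa using hk) hSdef hT
  have hRS := scalarCurvature_eq hU hF hinj hR hb hν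
  rw [← hGb, ← hS] at hRS
  have hRS' : R (γ b) - n * ((n : ℝ) - 1) = S.trace ^ 2 - (S * S).trace := by rw [hRS]; ring
  rw [hTβ, Fintype.card_fin, Fintype.card_fin] at h1 h2
  rw [hRS']
  refine ⟨h1, h2.trans ?_⟩
  rw [pd_last_conf, hGεb, inner_slice_zero, inner_vertical, ← hα, ← hc]
  constructor
  · rintro ⟨r, hr, hdim⟩
    -- Since `α ≠ 0`, the relation `r = α κ + c` between the two scalars can be solved for `κ`.
    have hκ : α * ((r - c) / α) + c = r := by field_simp; ring
    refine ⟨(r - c) / α, ?_, by rw [hκ]; exact hdim⟩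
    rw [hTL] at hr
    have h3 : α • L = (r - c) • (1 : Matrix (Fin k) (Fin k) ℝ) := by
      rw [sub_smul, ← hr, add_sub_cancel_right]
    rw [div_eq_inv_mul, mul_smul, ← h3, smul_smul, inv_mul_cancel₀ hα0, one_smul]
  · rintro ⟨κ, hκ, hdim⟩
    exact ⟨α * κ + c, by rw [hTL, hκ, smul_smul, ← add_smul], hdim⟩

end Comparison

/-! ### Passage from the manifold to charts -/

lemma IsLocalParam.contMDiffAt {n : ℕ} {M : Type*} [TopologicalSpace M] [ChartedSpace (E n) M]
    {S : Set M} {W : Set (E (n - 1))} {s : E (n - 1) → M} {b : E (n - 1)}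
    (hs : IsLocalParam S W s) (hb : b ∈ W) : ContMDiffAt 𝓘(ℝ, E (n - 1)) (𝓡 n) 2 s b :=
  hs.2.1.contMDiffAt (hs.1.mem_nhds hb)

section Charts

variable {n : ℕ} {M : Type*} [TopologicalSpace M] [ChartedSpace (E n) M] [IsManifold (𝓡 n) 2 M]
  {e : OpenPartialHomeomorph M (E n)}

lemma contMDiffAt_chart (he : e ∈ atlas (E n) M) {p : M} (hp : p ∈ e.source) :
    ContMDiffAt (𝓡 n) 𝓘(ℝ, E n) 2 e p :=
  (contMDiffOn_of_mem_maximalAtlas (IsManifold.subset_maximalAtlas he)).contMDiffAt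
    (e.open_source.mem_nhds hp)

lemma contMDiffAt_chart_symm (he : e ∈ atlas (E n) M) {u : E n} (hu : u ∈ e.target) :
    ContMDiffAt 𝓘(ℝ, E n) (𝓡 n) 2 e.symm u :=
  (contMDiffOn_symm_of_mem_maximalAtlas (IsManifold.subset_maximalAtlas he)).contMDiffAt
    (e.open_target.mem_nhds hu)

lemma injective_mfderiv_chart (he : e ∈ atlas (E n) M) {p : M} (hp : p ∈ e.source) :
    Function.Injective (mfderiv (𝓡 n) 𝓘(ℝ, E n) e p) := by
  have h1 : MDifferentiableAt 𝓘(ℝ, E n) (𝓡 n) e.symm (e p) :=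
    (contMDiffAt_chart_symm he (e.map_source hp)).mdifferentiableAt two_ne_zero
  have h2 := (contMDiffAt_chart he hp).mdifferentiableAt two_ne_zero
  have h3 : (e.symm ∘ e) =ᶠ[𝓝 p] id := by
    filter_upwards [e.open_source.mem_nhds hp] with q hq using e.left_inv hq
  have h4 := mfderiv_comp p h1 h2
  rw [h3.mfderiv_eq, mfderiv_id] at h4
  refine Function.LeftInverse.injective (g := mfderiv 𝓘(ℝ, E n) (𝓡 n) e.symm (e p)) fun v => ?_
  exact (congrArg (fun L => L v) h4).symm

lemma injective_mfderiv_chart_symm (he : e ∈ atlas (E n) M) {u : E n} (hu : u ∈ e.target) :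
    Function.Injective (mfderiv 𝓘(ℝ, E n) (𝓡 n) e.symm u) := by
  have h1 := (contMDiffAt_chart_symm he hu).mdifferentiableAt two_ne_zero
  have h2 : MDifferentiableAt (𝓡 n) 𝓘(ℝ, E n) e (e.symm u) :=
    (contMDiffAt_chart he (e.map_target hu)).mdifferentiableAt two_ne_zero
  have h3 : (e ∘ e.symm) =ᶠ[𝓝 u] id := by
    filter_upwards [e.open_target.mem_nhds hu] with q hq using e.right_inv hq
  have h4 := mfderiv_comp u h2 h1
  rw [h3.mfderiv_eq, mfderiv_id] at h4
  refine Function.LeftInverse.injective (g := mfderiv (𝓡 n) 𝓘(ℝ, E n) e (e.symm u)) fun v => ?_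
  exact (congrArg (fun L => L v) h4).symm

variable {ι : M → E (n + 1)}

lemma contDiffOn_comp_chart_symm (hι : IsC2Immersion ι) (he : e ∈ atlas (E n) M) :
    ContDiffOn ℝ 2 (ι ∘ e.symm) e.target := by
  intro u hu
  have := (hι.1 (e.symm u)).comp u (contMDiffAt_chart_symm he hu)
  exact this.contDiffAt.contDiffWithinAt

lemma injective_fderiv_comp_chart_symm (hι : IsC2Immersion ι) (he : e ∈ atlas (E n) M) :
    ∀ u ∈ e.target, Function.Injective (fderiv ℝ (ι ∘ e.symm) u) := by
  intro u hu
  have h1 := (contMDiffAt_chart_symm he hu).mdifferentiableAt two_ne_zero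
  have h2 := (hι.1 (e.symm u)).mdifferentiableAt two_ne_zero
  rw [← mfderiv_eq_fderiv, mfderiv_comp u h2 h1]
  exact (hι.2 _).comp (injective_mfderiv_chart_symm he hu)

lemma exists_pd_last_ne_zero (hι : IsC2Immersion ι) (he : e ∈ atlas (E n) M) {p : M}
    (hp : p ∈ e.source) (hreg : mfderiv (𝓡 n) 𝓘(ℝ, ℝ) (height ι) p ≠ 0) :
    ∃ l, pd l (ι ∘ e.symm) (e p) (Fin.last n) ≠ 0 := by
  by_contra! hcon
  refine hreg ?_
  have hd : DifferentiableAt ℝ (ι ∘ e.symm) (e p) :=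
    ((contDiffOn_comp_chart_symm hι he).contDiffAt
      (e.open_target.mem_nhds (e.map_source hp))).differentiableAt two_ne_zero
  have hd' : DifferentiableAt ℝ (fun u => (ι ∘ e.symm) u (Fin.last n)) (e p) :=
    (EuclideanSpace.proj (𝕜 := ℝ) (Fin.last n)).differentiableAt.comp (e p) hd
  have h0 : fderiv ℝ (fun u => (ι ∘ e.symm) u (Fin.last n)) (e p) = 0 := by
    ext v
    rw [fderiv_eq_sum_pd]
    simp_rw [pd_apply hd, hcon]
    simp
  have h1 : height ι =ᶠ[𝓝 p] (fun u => (ι ∘ e.symm) u (Fin.last n)) ∘ e := by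
    filter_upwards [e.open_source.mem_nhds hp] with q hq
    simp [height, e.left_inv hq]
  have h2 := (contMDiffAt_chart he hp).mdifferentiableAt two_ne_zero
  rw [h1.mfderiv_eq, mfderiv_comp p hd'.mdifferentiableAt h2, mfderiv_eq_fderiv, h0]
  exact ContinuousLinearMap.zero_comp _

variable {S : Set M} {W : Set (E (n - 1))} {s : E (n - 1) → M} {b : E (n - 1)}

lemma IsLocalParam.contDiffAt_chart_comp (hs : IsLocalParam S W s) (hb : b ∈ W)
    (he : e ∈ atlas (E n) M) (hbe : s b ∈ e.source) : ContDiffAt ℝ 2 (e ∘ s) b :=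
  ((contMDiffAt_chart he hbe).comp b (hs.contMDiffAt hb)).contDiffAt

lemma IsLocalParam.injective_fderiv_chart_comp (hs : IsLocalParam S W s) (hb : b ∈ W)
    (he : e ∈ atlas (E n) M) (hbe : s b ∈ e.source) :
    Function.Injective (fderiv ℝ (e ∘ s) b) := by
  have h1 := (hs.contMDiffAt hb).mdifferentiableAt two_ne_zero
  have h2 := (contMDiffAt_chart he hbe).mdifferentiableAt two_ne_zero
  rw [← mfderiv_eq_fderiv, mfderiv_comp b h2 h1]
  exact (injective_mfderiv_chart he hbe).comp (hs.2.2.2 b hb)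

end Charts

end

end SphereHypersurface

/-! ### The main theorem -/

open Filter Topology in
theorem mainTheorem7 {n : ℕ} (hn : 2 ≤ n)
    {M : Type*} [TopologicalSpace M] [ChartedSpace (SphereHypersurface.E n) M]
    [IsManifold (𝓡 n) 2 M]
    (ι : M → SphereHypersurface.E (n + 1)) (hι : SphereHypersurface.IsC2Immersion ι)
    (R : M → ℝ) (hR : SphereHypersurface.IsScalarCurvature ι R)
    (ε : ℝ) (hε : SphereHypersurface.IsRegularValue ι ε)
    (e : OpenPartialHomeomorph M (SphereHypersurface.E n))
    (he : e ∈ atlas (SphereHypersurface.E n) M)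
    (W : Set (SphereHypersurface.E (n - 1))) (s : SphereHypersurface.E (n - 1) → M)
    (hs : SphereHypersurface.IsLocalParam (SphereHypersurface.levelSet ι ε) W s)
    (b : SphereHypersurface.E (n - 1)) (hb : b ∈ W) (p : M) (hp : s b = p) (hpe : p ∈ e.source)
    (ν : SphereHypersurface.E (n + 1))
    (hν : SphereHypersurface.IsUnitNormal (ι ∘ e.symm) ν (e p))
    (η : SphereHypersurface.E n)
    (hη : SphereHypersurface.IsUnitNormal (SphereHypersurface.horizontal ∘ ι ∘ s) η b) :
    ((SphereHypersurface.shapeM ι e ν p).trace * SphereHypersurface.bracket ι ε s ν η b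
        ≥ (1 / 2) * (R p - n * ((n : ℝ) - 1))
          + n / (2 * ((n : ℝ) - 1)) * SphereHypersurface.bracket ι ε s ν η b ^ 2) ∧
    ((SphereHypersurface.shapeM ι e ν p).trace * SphereHypersurface.bracket ι ε s ν η b
        = (1 / 2) * (R p - n * ((n : ℝ) - 1))
          + n / (2 * ((n : ℝ) - 1)) * SphereHypersurface.bracket ι ε s ν η b ^ 2 ↔
      ∃ κ : ℝ, SphereHypersurface.shapeLevel ι ε s η b = κ • 1 ∧
        n - 1 ≤ Module.finrank ℝ
          (Module.End.eigenspace (Matrix.toLin' (SphereHypersurface.shapeM ι e ν p))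
            (inner ℝ ν (SphereHypersurface.slice 0 η) * κ
              + inner ℝ ν (SphereHypersurface.vertical n)
                * SphereHypersurface.pd (Fin.last n) SphereHypersurface.conf (ι p)))) := by
  subst hp
  have hb' : (e ∘ s) b ∈ e.target := e.map_source hpe
  have hinv : e.symm ((e ∘ s) b) = s b := e.left_inv hpe
  have hγ := hs.contDiffAt_chart_comp hb he hpe
  have hG : (ι ∘ s) =ᶠ[𝓝 b] fun y => (ι ∘ e.symm) ((e ∘ s) y) := by
    filter_upwards [(hs.contMDiffAt hb).continuousAt.eventually_mem
      (e.open_source.mem_nhds hpe)] with y hy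
    simp [e.left_inv hy]
  have hGε : ∀ᶠ y in 𝓝 b, (ι ∘ s) y (Fin.last n) = ε := by
    filter_upwards [hs.1.mem_nhds hb] with y hy using hs.2.2.1 hy
  have hcast : ((n - 1 : ℕ) : ℝ) = (n : ℝ) - 1 := by
    rw [Nat.cast_sub (by omega), Nat.cast_one]
  -- Here `F = ι ∘ e.symm`, `γ = e ∘ s` and `G = ι ∘ s`; they satisfy `G = F ∘ γ` only near `b`,
  -- where `s` stays in the chart domain. The bound `2 ≤ n` makes `k` positive.
  have key := SphereHypersurface.meanCurvature_comparison (n := n) (k := n - 1) (by omega)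
    (by omega) e.open_target
    (SphereHypersurface.contDiffOn_comp_chart_symm hι he)
    (SphereHypersurface.injective_fderiv_comp_chart_symm hι he) (hR e he) hγ
    (hs.injective_fderiv_chart_comp hb he hpe) hb' hG hGε
    (SphereHypersurface.exists_pd_last_ne_zero hι he hpe (hε _ (hs.2.2.1 hb))) hν hη
    (S := SphereHypersurface.shapeM ι e ν (s b)) rfl
    (L := SphereHypersurface.shapeLevel ι ε s η b) rfl
    (β := SphereHypersurface.bracket ι ε s ν η b) (by rw [hcast]; rfl)
  rw [hcast, Function.comp_apply, hinv] at key
  exact key
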